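/- All manifolds, metrics and maps are smooth ($C^\infty$), and manifolds are Hausdorff and without boundary. **Definitions.** Let $(M^m,g)$ and $(N^n,h)$ be Riemannian manifolds with $M$ compact. For a smooth map $u:M\to N$ and a local $g$-orthonormal frame $e_1,\dots,e_m$ put $$d_{(3)}u(X)=\sum_{j,k=1}^m h\big(du(X),du(e_j)\big)\,h\big(du(e_j),du(e_k)\big)\,du(e_k),\qquad \|d_{(3)}u\|^2=\sum_{i=1}^m h\big(d_{(3)}u(e_i),du(e_i)\big),$$ and let $$E_{\Phi_{(3)}}(u)=\int_M \tfrac16\|d_{(3)}u\|^2\,dv_g$$ be the $\Phi_{(3)}$-energy of $u$. A smooth variation of $u$ is a family $u_t:M\to N$, $|t|<\delta$, with $u_0=u$, that is smooth in $(t,x)$. The map $u$ is *$\Phi_{(3)}$-harmonic* if it is smooth and $\frac{d}{dt}\big|_{t=0}E_{\Phi_{(3)}}(u_t)=0$ for every smooth variation of $u$. It is *stable $\Phi_{(3)}$-harmonic* if moreover $\frac{d^2}{dt^2}\big|_{t=0}E_{\Phi_{(3)}}(u_t)\ge 0$ for every smooth variation of $u$. A Riemannian manifold $N^n$ is *$\Phi_{(3)}$-superstrongly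 unstable* ($\Phi_{(3)}$-SSU) if for some $q$ there is a smooth isometric immersion of $N$ in $\mathbb R^q$ whose second fundamental form $B$ satisfies $$\sum_{i=1}^n\Big(6\,\langle B(v,\epsilon_i),B(v,\epsilon_i)\rangle-\langle B(v,v),B(\epsilon_i,\epsilon_i)\rangle\Big)<0$$ for every $y\in N$ and every unit vector $v\in T_yN$, where $\epsilon_1,\dots,\epsilon_n$ is an orthonormal basis of $T_yN$. **Theorem.** Let $(N^n,h)$ be a compact $\Phi_{(3)}$-SSU manifold and let $(M^m,g)$ be any compact connected Riemannian manifold. Then every stable $\Phi_{(3)}$-harmonic map $u:(M,g)\to(N,h)$ is constant. -/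

import Mathlib

open Set MeasureTheory Bundle Manifold
open scoped ContDiff

/-!
Conventions. An `m`-dimensional smooth manifold (without boundary) is a type modelled on `𝓡 m` with
`IsManifold (𝓡 m) ∞ M`; a smooth Riemannian metric on it is a `RiemannianBundle` structure on the
tangent bundle with `IsContMDiffRiemannianBundle (𝓡 m) ∞`. Inner products of tangent vectors are
taken in this metric.
-/

noncomputable section Volume

variable {m : ℕ} {M : Type*} [TopologicalSpace M]
  [ChartedSpace (EuclideanSpace ℝ (Fin m)) M]
  [RiemannianBundle (fun x : M => TangentSpace (𝓡 m) x)]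

/-- The `i`-th coordinate vector field `∂ᵢ` of the preferred chart `φ` at `p`, at the point
`φ⁻¹ y`. -/
def coordField (p : M) (y : EuclideanSpace ℝ (Fin m)) (i : Fin m) :
    TangentSpace (𝓡 m) ((chartAt (EuclideanSpace ℝ (Fin m)) p).symm y) :=
  mfderiv (𝓡 m) (𝓡 m) (chartAt (EuclideanSpace ℝ (Fin m)) p).symm y
    (EuclideanSpace.single i (1 : ℝ))

/-- The matrix `g_{ij} = g(∂ᵢ, ∂ⱼ)` of the metric in the preferred chart at `p`. -/
def metricMatrix (p : M) (y : EuclideanSpace ℝ (Fin m)) : Matrix (Fin m) (Fin m) ℝ :=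
  Matrix.of fun i j => inner ℝ (coordField p y i) (coordField p y j)

/-- The Riemannian volume `√(det g_{ij}) dy¹ ⋯ dyᵐ` of the domain of the preferred chart at `p`,
as a measure on `M` that is carried by this domain. -/
def chartVolume [MeasurableSpace M] (p : M) : Measure M :=
  (((volume : Measure (EuclideanSpace ℝ (Fin m))).restrict
      (chartAt (EuclideanSpace ℝ (Fin m)) p).target).withDensity
    (fun y => ENNReal.ofReal (Real.sqrt (metricMatrix p y).det))).map
  (chartAt (EuclideanSpace ℝ (Fin m)) p).symm

/-- A smooth partition of unity `(ρ_p)` subordinate to the cover of `M` by the domains of its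
preferred charts. -/
def chartPartition (m : ℕ) (M : Type*) [TopologicalSpace M]
    [ChartedSpace (EuclideanSpace ℝ (Fin m)) M] [IsManifold (𝓡 m) ∞ M] [T2Space M]
    [SigmaCompactSpace M] : SmoothPartitionOfUnity M (𝓡 m) M univ :=
  Classical.choose
    (SmoothPartitionOfUnity.exists_isSubordinate_chartAt_source (I := 𝓡 m) (M := M))

/-- The Riemannian volume measure `dv_g`, glued from the volumes of the chart domains:
`∫ f dv_g = ∑_p ∫ (ρ_p f)(φ_p⁻¹ y) √(det g_{ij}) dy`. By the change of variables formula it does not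
depend on the partition of unity. -/
def riemannianVolume (m : ℕ) (M : Type*) [TopologicalSpace M]
    [ChartedSpace (EuclideanSpace ℝ (Fin m)) M] [IsManifold (𝓡 m) ∞ M] [T2Space M]
    [SigmaCompactSpace M] [RiemannianBundle (fun x : M => TangentSpace (𝓡 m) x)]
    [MeasurableSpace M] : Measure M :=
  Measure.sum fun p : M =>
    (chartVolume (m := m) p).withDensity (fun x => ENNReal.ofReal (chartPartition m M p x))

end Volume

noncomputable section Frame

variable {m : ℕ} {M : Type*} [TopologicalSpace M]
  [ChartedSpace (EuclideanSpace ℝ (Fin m)) M]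

instance finiteDimensional_tangentSpace (x : M) :
    FiniteDimensional ℝ (TangentSpace (𝓡 m) x) :=
  inferInstanceAs (FiniteDimensional ℝ (EuclideanSpace ℝ (Fin m)))

theorem finrank_tangentSpace (x : M) : Module.finrank ℝ (TangentSpace (𝓡 m) x) = m :=
  (finrank_euclideanSpace_fin : Module.finrank ℝ (EuclideanSpace ℝ (Fin m)) = m)

variable [RiemannianBundle (fun x : M => TangentSpace (𝓡 m) x)]

/-- An orthonormal basis `e₁, …, e_m` of the tangent space at `x`. All the sums over it below are
traces, so that they do not depend on its choice. -/
def tangentFrame (x : M) : OrthonormalBasis (Fin m) ℝ (TangentSpace (𝓡 m) x) :=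
  (stdOrthonormalBasis ℝ (TangentSpace (𝓡 m) x)).reindex (finCongr (finrank_tangentSpace x))

end Frame

noncomputable section Energy

variable {m n : ℕ} {M N : Type*}
  [TopologicalSpace M] [ChartedSpace (EuclideanSpace ℝ (Fin m)) M]
  [RiemannianBundle (fun x : M => TangentSpace (𝓡 m) x)]
  [TopologicalSpace N] [ChartedSpace (EuclideanSpace ℝ (Fin n)) N]
  [RiemannianBundle (fun y : N => TangentSpace (𝓡 n) y)]

/-- `d₍₃₎u(X) = ∑_{j,k} h(du X, du e_j) h(du e_j, du e_k) du e_k`. -/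
def dThree (u : M → N) (x : M) (X : TangentSpace (𝓡 m) x) : TangentSpace (𝓡 n) (u x) :=
  ∑ j : Fin m, ∑ k : Fin m,
    (inner ℝ (mfderiv (𝓡 m) (𝓡 n) u x X) (mfderiv (𝓡 m) (𝓡 n) u x (tangentFrame x j)) *
      inner ℝ (mfderiv (𝓡 m) (𝓡 n) u x (tangentFrame x j))
        (mfderiv (𝓡 m) (𝓡 n) u x (tangentFrame x k))) •
      mfderiv (𝓡 m) (𝓡 n) u x (tangentFrame x k)

/-- The `Φ₍₃₎`-energy density `e(u) = ‖d₍₃₎u‖² / 6`, where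
`‖d₍₃₎u‖² = ∑_i h(d₍₃₎u(e_i), du(e_i))`. -/
def phiThreeDensity (m n : ℕ) {M N : Type*}
    [TopologicalSpace M] [ChartedSpace (EuclideanSpace ℝ (Fin m)) M]
    [RiemannianBundle (fun x : M => TangentSpace (𝓡 m) x)]
    [TopologicalSpace N] [ChartedSpace (EuclideanSpace ℝ (Fin n)) N]
    [RiemannianBundle (fun y : N => TangentSpace (𝓡 n) y)] (u : M → N) (x : M) : ℝ :=
  (∑ i : Fin m, inner ℝ (dThree (m := m) (n := n) u x (tangentFrame x i))
    (mfderiv (𝓡 m) (𝓡 n) u x (tangentFrame x i))) / 6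

/-- The `Φ₍₃₎`-energy `E(u) = ∫_M e(u) dv_g`. -/
def phiThreeEnergy (m n : ℕ) {M N : Type*}
    [TopologicalSpace M] [ChartedSpace (EuclideanSpace ℝ (Fin m)) M] [IsManifold (𝓡 m) ∞ M]
    [T2Space M] [SigmaCompactSpace M] [MeasurableSpace M]
    [RiemannianBundle (fun x : M => TangentSpace (𝓡 m) x)]
    [TopologicalSpace N] [ChartedSpace (EuclideanSpace ℝ (Fin n)) N]
    [RiemannianBundle (fun y : N => TangentSpace (𝓡 n) y)] (u : M → N) : ℝ :=
  ∫ x, phiThreeDensity m n u x ∂(riemannianVolume m M)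

/-- `(U t)`, for `|t| < δ`, is a smooth variation of `u` (what happens for other `t` is irrelevant).
On a compact manifold `M` every variation is compactly supported. -/
def IsSmoothVariation (m n : ℕ) {M N : Type*}
    [TopologicalSpace M] [ChartedSpace (EuclideanSpace ℝ (Fin m)) M]
    [TopologicalSpace N] [ChartedSpace (EuclideanSpace ℝ (Fin n)) N]
    (u : M → N) (U : ℝ → M → N) : Prop :=
  U 0 = u ∧ ∃ δ > (0 : ℝ),
    ContMDiffOn (𝓘(ℝ, ℝ).prod (𝓡 m)) (𝓡 n) ∞ (fun p : ℝ × M => U p.1 p.2)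
      (Ioo (-δ) δ ×ˢ (univ : Set M))

/-- `Φ₍₃₎`-harmonic maps of a compact manifold `M`: smooth critical points of the `Φ₍₃₎`-energy. -/
def IsPhiThreeHarmonic (m n : ℕ) {M N : Type*}
    [TopologicalSpace M] [ChartedSpace (EuclideanSpace ℝ (Fin m)) M] [IsManifold (𝓡 m) ∞ M]
    [T2Space M] [CompactSpace M] [MeasurableSpace M]
    [RiemannianBundle (fun x : M => TangentSpace (𝓡 m) x)]
    [TopologicalSpace N] [ChartedSpace (EuclideanSpace ℝ (Fin n)) N]
    [RiemannianBundle (fun y : N => TangentSpace (𝓡 n) y)] (u : M → N) : Prop :=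
  ContMDiff (𝓡 m) (𝓡 n) ∞ u ∧
    ∀ U : ℝ → M → N, IsSmoothVariation m n u U →
      HasDerivAt (fun t => phiThreeEnergy m n (U t)) 0 0

/-- Stable `Φ₍₃₎`-harmonic maps: the second variation of the `Φ₍₃₎`-energy is nonnegative. (A
critical point that minimizes the energy locally along each smooth variation is stable in this
sense.) -/
def IsStablePhiThreeHarmonic (m n : ℕ) {M N : Type*}
    [TopologicalSpace M] [ChartedSpace (EuclideanSpace ℝ (Fin m)) M] [IsManifold (𝓡 m) ∞ M]
    [T2Space M] [CompactSpace M] [MeasurableSpace M]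
    [RiemannianBundle (fun x : M => TangentSpace (𝓡 m) x)]
    [TopologicalSpace N] [ChartedSpace (EuclideanSpace ℝ (Fin n)) N]
    [RiemannianBundle (fun y : N => TangentSpace (𝓡 n) y)] (u : M → N) : Prop :=
  IsPhiThreeHarmonic m n u ∧
    ∀ U : ℝ → M → N, IsSmoothVariation m n u U →
      0 ≤ iteratedDeriv 2 (fun t => phiThreeEnergy m n (U t)) 0

end Energy

noncomputable section Submanifold

variable {n q : ℕ} {N : Type*} [TopologicalSpace N] [ChartedSpace (EuclideanSpace ℝ (Fin n)) N]

/-- The differential at `y` of a map into `ℝ^q`, with values in `ℝ^q`. -/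
def euclideanDeriv (f : N → EuclideanSpace ℝ (Fin q)) (y : N) :
    TangentSpace (𝓡 n) y →L[ℝ] EuclideanSpace ℝ (Fin q) :=
  (NormedSpace.fromTangentSpace (f y)).toContinuousLinearMap.comp (mfderiv (𝓡 n) (𝓡 q) f y)

/-- A smooth isometric immersion of the Riemannian manifold `N` in `ℝ^q`. -/
def IsIsometricImmersion (n : ℕ) {q : ℕ} {N : Type*} [TopologicalSpace N]
    [ChartedSpace (EuclideanSpace ℝ (Fin n)) N]
    [RiemannianBundle (fun y : N => TangentSpace (𝓡 n) y)]
    (f : N → EuclideanSpace ℝ (Fin q)) : Prop :=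
  ContMDiff (𝓡 n) (𝓡 q) ∞ f ∧
    ∀ (y : N) (v w : TangentSpace (𝓡 n) y),
      inner ℝ (euclideanDeriv f y v) (euclideanDeriv f y w) = inner ℝ v w

/-- The second fundamental form `B(v, w) = (D_v (df(W)))^⊥` of an immersion `f` in `ℝ^q`, where `W`
is any vector field near `y` that extends `w`. Here `W` has constant components in the
preferred chart `φ` at `y`, so that `D_v (df(W)) = D²(f ∘ φ⁻¹)(dφ v, dφ w)`; and `⊥` is the
orthogonal projection of `ℝ^q` to the normal space of `f` at `y`. -/
def secondFundamentalForm (f : N → EuclideanSpace ℝ (Fin q)) (y : N)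
    (v w : TangentSpace (𝓡 n) y) : EuclideanSpace ℝ (Fin q) :=
  let φ := chartAt (EuclideanSpace ℝ (Fin n)) y
  let ξ : EuclideanSpace ℝ (Fin n) := mfderiv (𝓡 n) (𝓡 n) φ y v
  let η : EuclideanSpace ℝ (Fin n) := mfderiv (𝓡 n) (𝓡 n) φ y w
  (LinearMap.range (euclideanDeriv (n := n) f y).toLinearMap)ᗮ.starProjection
    (fderiv ℝ (fderiv ℝ (f ∘ φ.symm)) (φ y) ξ η)

/-- `Φ₍₃₎`-superstrongly unstable manifolds. -/
def IsPhiThreeSSU (n : ℕ) (N : Type*) [TopologicalSpace N]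
    [ChartedSpace (EuclideanSpace ℝ (Fin n)) N]
    [RiemannianBundle (fun y : N => TangentSpace (𝓡 n) y)] : Prop :=
  ∃ (q : ℕ) (f : N → EuclideanSpace ℝ (Fin q)), IsIsometricImmersion n f ∧
    ∀ (y : N) (v : TangentSpace (𝓡 n) y), ‖v‖ = 1 →
      ∑ i : Fin n,
        (6 * inner ℝ (secondFundamentalForm f y v (tangentFrame y i))
            (secondFundamentalForm f y v (tangentFrame y i)) -
          inner ℝ (secondFundamentalForm f y v v)
            (secondFundamentalForm f y (tangentFrame y i) (tangentFrame y i))) < 0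

end Submanifold

/-!
Let `f : N → ℝ^q` be an isometric immersion as in the definition of superstrong instability, `P y`
the orthogonal projection of `ℝ^q` to the tangent space at `y`, and `b_a` an orthonormal basis of
`ℝ^q`. The second variation of the energy of a stable map `u` is nonnegative along each tangential
field `P b_a`. The proof adds these up and shows that the sum is the integral of a nonpositive
function that vanishes only where `du` does.

All variations have the form `Ψ t ∘ u`, where `Ψ t` deforms the identity of `N`; `Ψ t` is built from
straight motions in charts and a partition of unity (`IsIsometricImmersion.exists_isDeformation`),
and no geodesics or flows are needed. Let `e_l` be an orthonormal basis of `T_{u(x)}N` that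
diagonalizes `du ∘ duᵀ`, with eigenvalues `μ_l ≥ 0`. As the energy density of `Ψ t ∘ u` is
`tr (D G_t)³ / 6`, where `D` is diagonal with entries `μ_l` and `G_t` is the Gram matrix of the
vectors `d(f ∘ Ψ t)(e_l)`, its first two time derivatives at `0` are explicit sums in the
derivatives of the velocity field and of the acceleration field
(`IsDeformation.timeDeriv_timeDeriv_phiThreeDensity`). No integration by parts is involved.

For the velocities `P b_a`, with accelerations `ζ_a`, three facts about the second
fundamental form `B` evaluate the sum over `a`:
* `∑_a |D_l P b_a|² = 2 ∑_k |B(e_l, e_k)|²`;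
* `⟪D_l P b_a, e_k⟫ + ⟪D_k P b_a, e_l⟫ = 2 ⟪b_a, B(e_l, e_k)⟫`;
* the normal part of `∑_a ζ_a` is `∑_k B(e_k, e_k)`, so that its derivative contributes
  `- ∑_k ⟪B(e_l, e_l), B(e_k, e_k)⟫`.

The tangential part of `∑_a ζ_a` contributes a first variation, which integrates to zero because `u`
is critical. The second fact gives the terms `4 μ_l² μ_k |B(e_l, e_k)|²`, which are at most
`4 μ_l³ |B(e_l, e_k)|²` after summation by the inequality of arithmetic and geometric means. In
total (`IsIsometricImmersion.sum_second_variation_le`) the integrand is at most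
`∑_l μ_l³ ∑_k (6 |B(e_l, e_k)|² - ⟪B(e_l, e_l), B(e_k, e_k)⟫)`, and superstrong instability says
that every coefficient of `μ_l³` is negative. Hence all `μ_l` vanish everywhere, `du = 0`, and `u`
is constant on the connected manifold `M`.
-/

/-! ### Smooth families of maps -/

noncomputable section SmoothFamilies

variable {m : ℕ} {M : Type*} [TopologicalSpace M] [ChartedSpace (EuclideanSpace ℝ (Fin m)) M]
  {E : Type*} [NormedAddCommGroup E] [NormedSpace ℝ E]

/-- A map from `M` to a normed space that is smooth in every preferred chart. -/
def SmoothInCharts (m : ℕ) {M E : Type*} [TopologicalSpace M]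
    [ChartedSpace (EuclideanSpace ℝ (Fin m)) M] [NormedAddCommGroup E] [NormedSpace ℝ E]
    (F : M → E) : Prop :=
  ∀ p : M, ContDiffOn ℝ ∞ (F ∘ (chartAt (EuclideanSpace ℝ (Fin m)) p).symm)
    (chartAt (EuclideanSpace ℝ (Fin m)) p).target

/-- A family `F t`, `|t| < δ`, of maps from `M` to a normed space that is jointly smooth in the
time and in the coordinates of every preferred chart. -/
def SmoothFamily (m : ℕ) {M E : Type*} [TopologicalSpace M]
    [ChartedSpace (EuclideanSpace ℝ (Fin m)) M] [NormedAddCommGroup E] [NormedSpace ℝ E]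
    (δ : ℝ) (F : ℝ → M → E) : Prop :=
  ∀ p : M, ContDiffOn ℝ ∞
    (fun s : ℝ × EuclideanSpace ℝ (Fin m) =>
      F s.1 ((chartAt (EuclideanSpace ℝ (Fin m)) p).symm s.2))
    (Ioo (-δ) δ ×ˢ (chartAt (EuclideanSpace ℝ (Fin m)) p).target)

/-- The time derivative of a family of maps. -/
def timeDeriv {M E : Type*} [NormedAddCommGroup E] [NormedSpace ℝ E] (F : ℝ → M → E) :
    ℝ → M → E :=
  fun t x => deriv (fun s => F s x) t

/-- The sets on which `SmoothFamily` requires joint smoothness are open, so that derivatives may be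
taken there without restriction to a set. -/
theorem isOpen_timeChart (δ : ℝ) (p : M) :
    IsOpen (Ioo (-δ) δ ×ˢ (chartAt (EuclideanSpace ℝ (Fin m)) p).target) :=
  isOpen_Ioo.prod (chartAt (EuclideanSpace ℝ (Fin m)) p).open_target

namespace SmoothFamily

variable {δ : ℝ} {F : ℝ → M → E}

theorem contDiffAt (hF : SmoothFamily m δ F) (p : M) {t : ℝ} (ht : t ∈ Ioo (-δ) δ)
    {z : EuclideanSpace ℝ (Fin m)} (hz : z ∈ (chartAt (EuclideanSpace ℝ (Fin m)) p).target) :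
    ContDiffAt ℝ ∞ (fun s : ℝ × EuclideanSpace ℝ (Fin m) =>
      F s.1 ((chartAt (EuclideanSpace ℝ (Fin m)) p).symm s.2)) (t, z) :=
  (hF p).contDiffAt ((isOpen_timeChart δ p).mem_nhds ⟨ht, hz⟩)

theorem hasDerivAt_chart (hF : SmoothFamily m δ F) (p : M) {t : ℝ} (ht : t ∈ Ioo (-δ) δ)
    {z : EuclideanSpace ℝ (Fin m)} (hz : z ∈ (chartAt (EuclideanSpace ℝ (Fin m)) p).target) :
    HasDerivAt (fun s => F s ((chartAt (EuclideanSpace ℝ (Fin m)) p).symm z))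
      (fderiv ℝ (fun s : ℝ × EuclideanSpace ℝ (Fin m) =>
        F s.1 ((chartAt (EuclideanSpace ℝ (Fin m)) p).symm s.2)) (t, z) (1, 0)) t := by
  have h1 := ((hF.contDiffAt p ht hz).differentiableAt (by simp)).hasFDerivAt
  exact h1.comp_hasDerivAt t ((hasDerivAt_id t).prodMk (hasDerivAt_const t z))

theorem timeDeriv_chart (hF : SmoothFamily m δ F) (p : M) {t : ℝ} (ht : t ∈ Ioo (-δ) δ)
    {z : EuclideanSpace ℝ (Fin m)} (hz : z ∈ (chartAt (EuclideanSpace ℝ (Fin m)) p).target) :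
    timeDeriv F t ((chartAt (EuclideanSpace ℝ (Fin m)) p).symm z) =
      fderiv ℝ (fun s : ℝ × EuclideanSpace ℝ (Fin m) =>
        F s.1 ((chartAt (EuclideanSpace ℝ (Fin m)) p).symm s.2)) (t, z) (1, 0) :=
  (hF.hasDerivAt_chart p ht hz).deriv

theorem hasDerivAt (hF : SmoothFamily m δ F) {t : ℝ} (ht : t ∈ Ioo (-δ) δ) (x : M) :
    HasDerivAt (fun s => F s x) (timeDeriv F t x) t := by
  have := hF.hasDerivAt_chart x ht (mem_chart_target (EuclideanSpace ℝ (Fin m)) x)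
  rw [← hF.timeDeriv_chart x ht (mem_chart_target (EuclideanSpace ℝ (Fin m)) x)] at this
  simpa only [(chartAt (EuclideanSpace ℝ (Fin m)) x).left_inv
    (mem_chart_source (EuclideanSpace ℝ (Fin m)) x)] using this

theorem smoothFamily_timeDeriv (hF : SmoothFamily m δ F) : SmoothFamily m δ (timeDeriv F) := by
  intro p
  have h : ContDiffOn ℝ ∞ (fun s => fderiv ℝ (fun s : ℝ × EuclideanSpace ℝ (Fin m) =>
        F s.1 ((chartAt (EuclideanSpace ℝ (Fin m)) p).symm s.2)) s (1, 0))
        (Ioo (-δ) δ ×ˢ (chartAt (EuclideanSpace ℝ (Fin m)) p).target) :=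
    ((hF p).fderiv_of_isOpen (isOpen_timeChart δ p) (by simp)).clm_apply contDiffOn_const
  exact h.congr fun s hs => hF.timeDeriv_chart p hs.1 hs.2

theorem slice (hF : SmoothFamily m δ F) {t : ℝ} (ht : t ∈ Ioo (-δ) δ) :
    SmoothInCharts m (F t) := fun p =>
  (hF p).comp (f := fun z : EuclideanSpace ℝ (Fin m) => (t, z))
    (contDiff_const.prodMk contDiff_id).contDiffOn fun _ hz => ⟨ht, hz⟩

theorem continuousOn (hF : SmoothFamily m δ F) :
    ContinuousOn (fun s : ℝ × M => F s.1 s.2) (Ioo (-δ) δ ×ˢ univ) := by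
  rintro ⟨t, x⟩ ⟨ht, -⟩
  apply ContinuousAt.continuousWithinAt
  set φ := chartAt (EuclideanSpace ℝ (Fin m)) x
  have hx : x ∈ φ.source := mem_chart_source _ x
  have h1 := (hF.contDiffAt x ht (φ.map_source hx)).continuousAt
  have h2 : ContinuousAt (fun s : ℝ × M => (s.1, φ s.2)) (t, x) :=
    continuousAt_fst.prodMk ((φ.continuousAt hx).comp continuousAt_snd)
  refine (ContinuousAt.comp (f := fun s : ℝ × M => (s.1, φ s.2)) (x := (t, x)) h1 h2).congr ?_
  have h3 : ∀ᶠ s : ℝ × M in nhds (t, x), s.2 ∈ φ.source :=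
    continuousAt_snd.eventually (φ.open_source.mem_nhds hx)
  filter_upwards [h3] with s hs
  simp only [Function.comp]
  rw [φ.left_inv hs]

theorem fderiv_slice (hF : SmoothFamily m δ F) (p : M) {t : ℝ} (ht : t ∈ Ioo (-δ) δ)
    {z : EuclideanSpace ℝ (Fin m)} (hz : z ∈ (chartAt (EuclideanSpace ℝ (Fin m)) p).target)
    (ξ : EuclideanSpace ℝ (Fin m)) :
    fderiv ℝ (F t ∘ (chartAt (EuclideanSpace ℝ (Fin m)) p).symm) z ξ =
      fderiv ℝ (fun s : ℝ × EuclideanSpace ℝ (Fin m) =>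
        F s.1 ((chartAt (EuclideanSpace ℝ (Fin m)) p).symm s.2)) (t, z) (0, ξ) := by
  have h1 := ((hF.contDiffAt p ht hz).differentiableAt (by simp)).hasFDerivAt
  have h3 := (h1.comp z (hasFDerivAt_prodMk_right t z)).fderiv
  change fderiv ℝ (F t ∘ (chartAt (EuclideanSpace ℝ (Fin m)) p).symm) z = _ at h3
  rw [h3]
  rfl

/-- The time derivative commutes with the derivative in the space variable. -/
theorem hasDerivAt_fderiv (hF : SmoothFamily m δ F) (p : M) {t : ℝ} (ht : t ∈ Ioo (-δ) δ)
    {z : EuclideanSpace ℝ (Fin m)} (hz : z ∈ (chartAt (EuclideanSpace ℝ (Fin m)) p).target)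
    (ξ : EuclideanSpace ℝ (Fin m)) :
    HasDerivAt (fun s => fderiv ℝ (F s ∘ (chartAt (EuclideanSpace ℝ (Fin m)) p).symm) z ξ)
      (fderiv ℝ (timeDeriv F t ∘ (chartAt (EuclideanSpace ℝ (Fin m)) p).symm) z ξ) t := by
  set φ := chartAt (EuclideanSpace ℝ (Fin m)) p
  set G : ℝ × EuclideanSpace ℝ (Fin m) → E := fun s => F s.1 (φ.symm s.2) with hG
  have hev : ∀ᶠ s in nhds t, s ∈ Ioo (-δ) δ := isOpen_Ioo.mem_nhds ht
  have hG2 : ContDiffAt ℝ ∞ G (t, z) := hF.contDiffAt p ht hz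
  have hdG : DifferentiableAt ℝ (fderiv ℝ G) (t, z) :=
    (hG2.fderiv_right (m := 1) (by norm_cast)).differentiableAt (by simp)
  have hsymm := hG2.isSymmSndFDerivAt (by simp; norm_cast)
  have h4 : HasDerivAt (fun s => fderiv ℝ G (s, z) (0, ξ))
      (fderiv ℝ (fderiv ℝ G) (t, z) (1, 0) (0, ξ)) t := by
    have h5 := hdG.hasFDerivAt.comp_hasDerivAt t
      ((hasDerivAt_id t).prodMk (hasDerivAt_const t z))
    have := h5.clm_apply (hasDerivAt_const t ((0 : ℝ), ξ))
    simpa using this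
  have h6 : fderiv ℝ (timeDeriv F t ∘ φ.symm) z ξ =
      fderiv ℝ (fderiv ℝ G) (t, z) (1, 0) (0, ξ) := by
    rw [hF.smoothFamily_timeDeriv.fderiv_slice p ht hz, hsymm.eq]
    have h7 : (fun s : ℝ × EuclideanSpace ℝ (Fin m) => timeDeriv F s.1 (φ.symm s.2))
        =ᶠ[nhds (t, z)] fun s => fderiv ℝ G s (1, 0) := by
      filter_upwards [(isOpen_timeChart δ p).mem_nhds ⟨ht, hz⟩] with s hs
      exact hF.timeDeriv_chart p hs.1 hs.2
    rw [h7.fderiv_eq]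
    have h8 := hdG.hasFDerivAt.clm_apply
      (hasFDerivAt_const ((1 : ℝ), (0 : EuclideanSpace ℝ (Fin m))) (t, z))
    rw [h8.fderiv]
    simp
  rw [h6]
  refine h4.congr_of_eventuallyEq ?_
  filter_upwards [hev] with s hs
  exact hF.fderiv_slice p hs hz ξ

end SmoothFamily

variable [IsManifold (𝓡 m) ∞ M]

theorem ContMDiff.smoothInCharts {F : M → E} (hF : ContMDiff (𝓡 m) 𝓘(ℝ, E) ∞ F) :
    SmoothInCharts m F := by
  intro p
  rw [← contMDiffOn_iff_contDiffOn]
  exact hF.comp_contMDiffOn (contMDiffOn_chart_symm (I := 𝓡 m) (x := p))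

theorem contMDiffOn_timeChart (s : Set ℝ) (p : M) :
    ContMDiffOn 𝓘(ℝ, ℝ × EuclideanSpace ℝ (Fin m)) (𝓘(ℝ, ℝ).prod (𝓡 m)) ∞
      (fun s : ℝ × EuclideanSpace ℝ (Fin m) =>
        (s.1, (chartAt (EuclideanSpace ℝ (Fin m)) p).symm s.2))
      (s ×ˢ (chartAt (EuclideanSpace ℝ (Fin m)) p).target) := by
  refine ContMDiffOn.prodMk contDiff_fst.contMDiff.contMDiffOn ?_
  exact (contMDiffOn_chart_symm (I := 𝓡 m) (x := p)).comp
    contDiff_snd.contMDiff.contMDiffOn fun s hs => hs.2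

theorem ContMDiffOn.smoothFamily {δ : ℝ} {F : ℝ → M → E}
    (hF : ContMDiffOn (𝓘(ℝ, ℝ).prod (𝓡 m)) 𝓘(ℝ, E) ∞ (fun s : ℝ × M => F s.1 s.2)
      (Ioo (-δ) δ ×ˢ univ)) : SmoothFamily m δ F := by
  intro p
  rw [← contMDiffOn_iff_contDiffOn]
  exact hF.comp (contMDiffOn_timeChart _ p) fun s hs => ⟨hs.1, mem_univ _⟩

end SmoothFamilies

/-! ### Gram matrices, principal directions and projections -/

section LinearAlgebra

variable {E F : Type*} [NormedAddCommGroup E] [InnerProductSpace ℝ E]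
  [NormedAddCommGroup F] [InnerProductSpace ℝ F]
  {ι κ : Type*} [Fintype ι] [Fintype κ]

/-- The trace of a bilinear map does not depend on the orthonormal basis. -/
theorem OrthonormalBasis.sum_apply_self_eq {V : Type*} [AddCommGroup V] [Module ℝ V]
    (e : OrthonormalBasis ι ℝ E) (e' : OrthonormalBasis κ ℝ E) (b : E →ₗ[ℝ] E →ₗ[ℝ] V) :
    ∑ i, b (e i) (e i) = ∑ k, b (e' k) (e' k) := by
  classical
  have h : ∀ i, b (e i) (e i) =
      ∑ k, ∑ l, (inner ℝ (e' k) (e i) * inner ℝ (e i) (e' l)) • b (e' k) (e' l) := by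
    intro i
    conv_lhs => rw [← e'.sum_repr' (e i)]
    simp only [map_sum, map_smul, LinearMap.sum_apply, LinearMap.smul_apply, Finset.smul_sum,
      smul_smul]
    rw [Finset.sum_comm]
    refine Finset.sum_congr rfl fun k _ => Finset.sum_congr rfl fun l _ => ?_
    rw [real_inner_comm (e' l), mul_comm]
  simp only [h]
  rw [Finset.sum_comm]
  refine Finset.sum_congr rfl fun k _ => ?_
  rw [Finset.sum_comm]
  simp only [← Finset.sum_smul, e.sum_inner_mul_inner]
  simp [orthonormal_iff_ite.1 e'.orthonormal]

/-- The Gram matrix of the image of a family, in terms of its components in an orthonormal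
basis. -/
theorem gram_comp_eq_mul {ι : Type*} (e : OrthonormalBasis κ ℝ E) (v : ι → E) (T : E →ₗ[ℝ] F) :
    Matrix.gram ℝ (fun i => T (v i)) =
      (Matrix.of fun i k => inner ℝ (v i) (e k)) * Matrix.gram ℝ (fun k => T (e k)) *
        (Matrix.of fun i k => inner ℝ (v i) (e k)).transpose := by
  ext i j
  conv_lhs => rw [Matrix.gram_apply, ← e.sum_repr' (v i), ← e.sum_repr' (v j)]
  simp only [map_sum, map_smul, sum_inner, inner_sum, real_inner_smul_left, real_inner_smul_right,
    Matrix.mul_apply, Matrix.transpose_apply, Matrix.of_apply, Matrix.gram_apply, Finset.sum_mul]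
  refine Finset.sum_congr rfl fun k _ => Finset.sum_congr rfl fun l _ => ?_
  rw [real_inner_comm (v i), real_inner_comm (v j)]
  ring

/-- `tr A³`, where `A` is the Gram matrix of the image of an orthonormal basis, computed in an
arbitrary basis with Gram matrix `g`. -/
theorem trace_gram_cube_eq [DecidableEq κ] (e : OrthonormalBasis κ ℝ E) (v : κ → E)
    (T : E →ₗ[ℝ] F) (hv : (Matrix.gram ℝ v).det ≠ 0) :
    (Matrix.gram ℝ (fun k => T (e k)) ^ 3).trace =
      (((Matrix.gram ℝ v)⁻¹ * Matrix.gram ℝ (fun k => T (v k))) ^ 3).trace := by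
  set s : Matrix κ κ ℝ := Matrix.of fun i k => inner ℝ (v i) (e k) with hs
  set A := Matrix.gram ℝ (fun k => T (e k))
  have hg : Matrix.gram ℝ v = s * s.transpose := by
    have := gram_comp_eq_mul e v (LinearMap.id : E →ₗ[ℝ] E)
    have h1 : Matrix.gram ℝ (fun k => e k) = 1 := by
      ext i j
      simp [Matrix.gram_apply, orthonormal_iff_ite.1 e.orthonormal, Matrix.one_apply]
    simpa [h1] using this
  have hs0 : IsUnit s.det := by
    rw [hg, Matrix.det_mul] at hv
    exact isUnit_iff_ne_zero.2 (left_ne_zero_of_mul hv)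
  have hst : IsUnit s.transpose.det := by rwa [Matrix.det_transpose]
  -- `g⁻¹ (s A sᵀ)` is conjugate to `A`.
  rw [gram_comp_eq_mul e v T, hg, Matrix.mul_inv_rev]
  have h2 : s.transpose⁻¹ * s⁻¹ * (s * A * s.transpose) = s.transpose⁻¹ * A * s.transpose := by
    simp only [Matrix.mul_assoc, Matrix.nonsing_inv_mul_cancel_left _ _ hs0]
  rw [h2]
  have h3 : (s.transpose⁻¹ * A * s.transpose) ^ 3 = s.transpose⁻¹ * A ^ 3 * s.transpose := by
    simp only [pow_succ, pow_zero, one_mul, Matrix.mul_assoc,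
      Matrix.mul_nonsing_inv_cancel_left _ _ hst]
  rw [h3, Matrix.trace_mul_comm, ← Matrix.mul_assoc, Matrix.mul_nonsing_inv _ hst, Matrix.one_mul]

/-- A finite family of vectors `v i` is put into principal position: there is an orthonormal basis
that diagonalizes `w ↦ ∑ i, ⟪v i, w⟫ v i`. -/
theorem exists_orthonormalBasis_diagonal [FiniteDimensional ℝ E] {n : ℕ}
    (hn : Module.finrank ℝ E = n) (v : ι → E) :
    ∃ (e : OrthonormalBasis (Fin n) ℝ E) (μ : Fin n → ℝ), (∀ l, 0 ≤ μ l) ∧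
      ∀ l k, ∑ i, inner ℝ (v i) (e l) * inner ℝ (v i) (e k) = if l = k then μ l else 0 := by
  let S : E →ₗ[ℝ] E := ∑ i, (innerₗ E (v i)).smulRight (v i)
  have hS : ∀ w, S w = ∑ i, inner ℝ (v i) w • v i := fun w => by simp [S]
  have hsymm : S.IsSymmetric := fun a b => by
    rw [hS, hS, sum_inner, inner_sum]
    refine Finset.sum_congr rfl fun i _ => ?_
    rw [real_inner_smul_left, real_inner_smul_right, real_inner_comm (v i) a]
    ring
  refine ⟨hsymm.eigenvectorBasis hn, hsymm.eigenvalues hn, ?_⟩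
  have key : ∀ l k, ∑ i, inner ℝ (v i) (hsymm.eigenvectorBasis hn l) *
      inner ℝ (v i) (hsymm.eigenvectorBasis hn k) =
        if l = k then hsymm.eigenvalues hn l else 0 := by
    intro l k
    have h1 : inner ℝ (S (hsymm.eigenvectorBasis hn l)) (hsymm.eigenvectorBasis hn k) =
        if l = k then hsymm.eigenvalues hn l else 0 := by
      rw [hsymm.apply_eigenvectorBasis]
      simp only [RCLike.ofReal_real_eq_id, id, real_inner_smul_left,
        orthonormal_iff_ite.1 (hsymm.eigenvectorBasis hn).orthonormal]
      split_ifs <;> simp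
    rw [← h1, hS, sum_inner]
    simp only [real_inner_smul_left]
  refine ⟨fun l => ?_, key⟩
  have := key l l
  rw [if_pos rfl] at this
  rw [← this]
  exact Finset.sum_nonneg fun i _ => mul_self_nonneg _

/-- In principal position, `tr A³` is a polynomial in the principal stretches `μ` and the Gram
matrix of the principal directions. -/
theorem trace_gram_cube_eq_sum [DecidableEq ι] [DecidableEq κ] (e : OrthonormalBasis κ ℝ E)
    (v : ι → E) (T : E →ₗ[ℝ] F) (μ : κ → ℝ)
    (h : ∀ l k, ∑ i, inner ℝ (v i) (e l) * inner ℝ (v i) (e k) = if l = k then μ l else 0) :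
    (Matrix.gram ℝ (fun k => T (v k)) ^ 3).trace =
      ∑ l, ∑ k, ∑ r, μ l * μ k * μ r * (inner ℝ (T (e l)) (T (e k)) *
        inner ℝ (T (e k)) (T (e r)) * inner ℝ (T (e r)) (T (e l))) := by
  rw [gram_comp_eq_mul e v T]
  set c : Matrix ι κ ℝ := Matrix.of fun i k => inner ℝ (v i) (e k)
  set Γ := Matrix.gram ℝ (fun k => T (e k)) with hΓ
  have hD : c.transpose * c = Matrix.diagonal μ := by
    ext l k
    simp only [Matrix.mul_apply, Matrix.transpose_apply, c, Matrix.of_apply, h,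
      Matrix.diagonal_apply]
  have h1 : (c * Γ * c.transpose) ^ 3 =
      c * (Γ * (c.transpose * c) * Γ * (c.transpose * c) * Γ * c.transpose) := by
    simp only [pow_succ, pow_zero, one_mul, Matrix.mul_assoc]
  rw [h1, Matrix.trace_mul_comm, Matrix.mul_assoc _ c.transpose c, hD]
  set Y := Γ * Matrix.diagonal μ with hYdef
  have hY : ∀ l k, Y l k = inner ℝ (T (e l)) (T (e k)) * μ k := fun l k => by
    rw [hYdef, Matrix.mul_diagonal, hΓ, Matrix.gram_apply]
  have h2 : Y * Γ * Matrix.diagonal μ * Γ * Matrix.diagonal μ = Y * Y * Y := by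
    simp only [hYdef, Matrix.mul_assoc]
  rw [h2]
  simp only [Matrix.trace, Matrix.diag, Matrix.mul_apply, hY, Finset.sum_mul]
  refine Finset.sum_congr rfl fun l _ => ?_
  rw [Finset.sum_comm]
  refine Finset.sum_congr rfl fun k _ => Finset.sum_congr rfl fun r _ => ?_
  ring

/-- The inequality of arithmetic and geometric means `3 μ_l² μ_k ≤ 2 μ_l³ + μ_k³`, summed against
the symmetric weights `G l k ^ 2`. -/
theorem sum_sq_mul_le_sum_cube (μ : κ → ℝ) (hμ : ∀ l, 0 ≤ μ l) (G : κ → κ → ℝ)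
    (hG : ∀ l k, G l k = G k l) :
    ∑ l, ∑ k, μ l ^ 2 * μ k * G l k ^ 2 ≤ ∑ l, μ l ^ 3 * ∑ k, G l k ^ 2 := by
  have h1 : ∀ l k, μ l ^ 2 * μ k * G l k ^ 2 ≤
      (2 * (μ l ^ 3 * G l k ^ 2) + μ k ^ 3 * G k l ^ 2) / 3 := by
    intro l k
    have : μ l ^ 2 * μ k ≤ (2 * μ l ^ 3 + μ k ^ 3) / 3 := by
      -- `2 a³ + b³ - 3 a² b = (2 a + b) (a - b)²`
      nlinarith [mul_nonneg (add_nonneg (mul_nonneg zero_le_two (hμ l)) (hμ k))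
        (sq_nonneg (μ l - μ k))]
    rw [hG k l]
    nlinarith [mul_le_mul_of_nonneg_right this (sq_nonneg (G l k))]
  refine (Finset.sum_le_sum fun l _ => Finset.sum_le_sum fun k _ => h1 l k).trans (le_of_eq ?_)
  simp only [← Finset.sum_div, Finset.sum_add_distrib, ← Finset.mul_sum]
  rw [Finset.sum_comm (f := fun l k => μ k ^ 3 * G k l ^ 2)]
  simp only [← Finset.mul_sum]
  ring

/-- If `D` is the derivative of a family of orthogonal projections at the projection `P` to the
span of the orthonormal family `τ`, then `D` exchanges this span with its orthogonal complement, so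
that one half of its Hilbert–Schmidt norm is carried by the span. -/
theorem sum_norm_sq_eq_two_mul_of_projection (b : OrthonormalBasis κ ℝ F) {τ : ι → F}
    (hτ : Orthonormal ℝ τ) (P D : F →ₗ[ℝ] F) (hP : ∀ x, P x = ∑ l, inner ℝ (τ l) x • τ l)
    (hD : D.IsSymmetric) (hDP : ∀ x, D x = D (P x) + P (D x)) :
    ∑ a, inner ℝ (D (b a)) (D (b a)) = 2 * ∑ l, inner ℝ (D (τ l)) (D (τ l)) := by
  classical
  have hPτ : ∀ l, P (τ l) = τ l := fun l => by
    simp [hP, orthonormal_iff_ite.1 hτ]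
  have h0 : ∀ l, P (D (τ l)) = 0 := fun l => by
    have := hDP (τ l)
    rw [hPτ] at this
    simpa using this
  have horth : ∀ l k, inner ℝ (τ k) (D (τ l)) = 0 := fun l k => by
    have := congrArg (inner ℝ (τ k)) (h0 l)
    simpa [hP, inner_sum, real_inner_smul_right, orthonormal_iff_ite.1 hτ] using this
  have h1 : ∀ x, D (P x) = ∑ l, inner ℝ (τ l) x • D (τ l) := fun x => by simp [hP]
  have h2 : ∀ x, P (D x) = ∑ l, inner ℝ (D (τ l)) x • τ l := fun x => by
    rw [hP]
    exact Finset.sum_congr rfl fun l _ => by rw [hD (τ l) x]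
  have h3 : ∀ x, inner ℝ (D x) (D x) =
      (∑ l, ∑ k, (inner ℝ (τ l) x * inner ℝ x (τ k)) * inner ℝ (D (τ l)) (D (τ k))) +
        ∑ l, inner ℝ (D (τ l)) x * inner ℝ x (D (τ l)) := by
    intro x
    -- `D` maps the span of `τ` to its orthogonal complement.
    have hc : inner ℝ (D (P x)) (P (D x)) = (0 : ℝ) := by
      rw [h1, h2, sum_inner]
      refine Finset.sum_eq_zero fun l _ => ?_
      rw [inner_sum]
      refine Finset.sum_eq_zero fun k _ => ?_
      rw [real_inner_smul_left, real_inner_smul_right, real_inner_comm (τ k) (D (τ l)), horth]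
      ring
    rw [hDP x, inner_add_left, inner_add_right, inner_add_right,
      real_inner_comm (D (P x)) (P (D x)), hc, h1, h2]
    simp only [sum_inner, inner_sum, real_inner_smul_left, real_inner_smul_right,
      orthonormal_iff_ite.1 hτ, mul_ite, mul_one, mul_zero, Finset.sum_ite_eq', Finset.mem_univ,
      if_true, add_zero, zero_add]
    congr 1
    · rw [Finset.sum_comm]
      refine Finset.sum_congr rfl fun l _ => Finset.sum_congr rfl fun k _ => ?_
      rw [real_inner_comm (τ k) x]
      ring
    · refine Finset.sum_congr rfl fun l _ => ?_
      rw [real_inner_comm x (D (τ l))]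
  have h4 : ∑ a, ∑ l, inner ℝ (D (τ l)) (b a) * inner ℝ (b a) (D (τ l)) =
      ∑ l, inner ℝ (D (τ l)) (D (τ l)) := by
    rw [Finset.sum_comm]
    exact Finset.sum_congr rfl fun l _ => b.sum_inner_mul_inner _ _
  have h5 : ∑ a, ∑ l, ∑ k, (inner ℝ (τ l) (b a) * inner ℝ (b a) (τ k)) *
      inner ℝ (D (τ l)) (D (τ k)) = ∑ l, inner ℝ (D (τ l)) (D (τ l)) := by
    rw [Finset.sum_comm]
    refine Finset.sum_congr rfl fun l _ => ?_
    rw [Finset.sum_comm]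
    simp only [← Finset.sum_mul, b.sum_inner_mul_inner, orthonormal_iff_ite.1 hτ]
    simp
  rw [Finset.sum_congr rfl fun a _ => h3 (b a), Finset.sum_add_distrib, h4, h5]
  ring

end LinearAlgebra

/-! ### Derivatives in charts and the metric -/

section Matrices

variable {E : Type*} [NormedAddCommGroup E] [NormedSpace ℝ E] {κ : Type*} [Fintype κ]
  [DecidableEq κ] {r : WithTop ℕ∞}

theorem ContDiffOn.matrix_det {s : Set E} {A : E → Matrix κ κ ℝ}
    (hA : ∀ i j, ContDiffOn ℝ r (fun z => A z i j) s) :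
    ContDiffOn ℝ r (fun z => (A z).det) s := by
  simp only [Matrix.det_apply']
  exact ContDiffOn.sum fun σ _ => contDiffOn_const.mul (contDiffOn_prod fun i _ => hA _ _)

theorem ContDiffOn.matrix_mul {κ : Type*} [Fintype κ] {s : Set E} {A B : E → Matrix κ κ ℝ}
    (hA : ∀ i j, ContDiffOn ℝ r (fun z => A z i j) s)
    (hB : ∀ i j, ContDiffOn ℝ r (fun z => B z i j) s) (i j : κ) :
    ContDiffOn ℝ r (fun z => (A z * B z) i j) s := by
  simp only [Matrix.mul_apply]
  exact ContDiffOn.sum fun k _ => (hA _ _).mul (hB _ _)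

theorem ContDiffOn.matrix_inv {s : Set E} {A : E → Matrix κ κ ℝ}
    (hA : ∀ i j, ContDiffOn ℝ r (fun z => A z i j) s) (h0 : ∀ z ∈ s, (A z).det ≠ 0) (i j : κ) :
    ContDiffOn ℝ r (fun z => (A z)⁻¹ i j) s := by
  simp only [Matrix.inv_def, Ring.inverse_eq_inv, Matrix.smul_apply, smul_eq_mul,
    Matrix.adjugate_apply]
  refine ((ContDiffOn.matrix_det hA).inv h0).mul (ContDiffOn.matrix_det fun k l => ?_)
  by_cases h : k = j
  · subst h
    simpa using contDiffOn_const
  · simpa [Matrix.updateRow_ne h] using hA k l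

end Matrices

section ChartDerivatives

variable {m n q : ℕ} {M N : Type*}
  [TopologicalSpace M] [ChartedSpace (EuclideanSpace ℝ (Fin m)) M]
  [TopologicalSpace N] [ChartedSpace (EuclideanSpace ℝ (Fin n)) N]

theorem euclideanDeriv_comp {f : N → EuclideanSpace ℝ (Fin q)} {u : M → N} {x : M}
    (hf : MDifferentiableAt (𝓡 n) (𝓡 q) f (u x)) (hu : MDifferentiableAt (𝓡 m) (𝓡 n) u x)
    (v : TangentSpace (𝓡 m) x) :
    euclideanDeriv (fun x => f (u x)) x v = euclideanDeriv f (u x) (mfderiv (𝓡 m) (𝓡 n) u x v) :=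
  mfderiv_comp_apply x hf hu v

variable [IsManifold (𝓡 m) ∞ M]

/-- The differential of `w`, applied to a vector with constant components in a chart, is a
derivative of `w` in coordinates. -/
theorem euclideanDeriv_mfderiv_chart_symm {w : M → EuclideanSpace ℝ (Fin q)} (p : M)
    {z : EuclideanSpace ℝ (Fin m)} (hz : z ∈ (chartAt (EuclideanSpace ℝ (Fin m)) p).target)
    (hw : MDifferentiableAt (𝓡 m) (𝓡 q) w ((chartAt (EuclideanSpace ℝ (Fin m)) p).symm z))
    (ξ : EuclideanSpace ℝ (Fin m)) :
    euclideanDeriv w ((chartAt (EuclideanSpace ℝ (Fin m)) p).symm z)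
      (mfderiv (𝓡 m) (𝓡 m) (chartAt (EuclideanSpace ℝ (Fin m)) p).symm z ξ) =
      fderiv ℝ (w ∘ (chartAt (EuclideanSpace ℝ (Fin m)) p).symm) z ξ := by
  have h1 := mdifferentiableAt_atlas_symm (I := 𝓡 m)
    (chart_mem_atlas (EuclideanSpace ℝ (Fin m)) p) hz
  have h2 := mfderiv_comp_apply z hw h1 ξ
  rw [mfderiv_eq_fderiv] at h2
  exact h2.symm

theorem mfderiv_chart_symm_bijective {p : M} {z : EuclideanSpace ℝ (Fin m)}
    (hz : z ∈ (chartAt (EuclideanSpace ℝ (Fin m)) p).target) :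
    Function.Bijective (mfderiv (𝓡 m) (𝓡 m) (chartAt (EuclideanSpace ℝ (Fin m)) p).symm z) :=
  (mdifferentiable_chart (I := 𝓡 m) p).symm.mfderiv_bijective hz

theorem euclideanDeriv_eq_fderiv {w : M → EuclideanSpace ℝ (Fin q)} {p x : M}
    (hx : x ∈ (chartAt (EuclideanSpace ℝ (Fin m)) p).source)
    (hw : MDifferentiableAt (𝓡 m) (𝓡 q) w x) (v : TangentSpace (𝓡 m) x) :
    euclideanDeriv w x v =
      fderiv ℝ (w ∘ (chartAt (EuclideanSpace ℝ (Fin m)) p).symm)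
        (chartAt (EuclideanSpace ℝ (Fin m)) p x)
        (mfderiv (𝓡 m) (𝓡 m) (chartAt (EuclideanSpace ℝ (Fin m)) p) x v) := by
  set φ := chartAt (EuclideanSpace ℝ (Fin m)) p
  have hz : φ x ∈ φ.target := φ.map_source hx
  have h1 := mdifferentiableAt_atlas_symm (I := 𝓡 m)
    (chart_mem_atlas (EuclideanSpace ℝ (Fin m)) p) hz
  have h2 := mdifferentiableAt_atlas (I := 𝓡 m)
    (chart_mem_atlas (EuclideanSpace ℝ (Fin m)) p) hx
  have h3 : MDifferentiableAt (𝓡 m) (𝓡 q) (w ∘ φ.symm) (φ x) := by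
    refine MDifferentiableAt.comp _ ?_ h1
    rwa [φ.left_inv hx]
  have h4 : w =ᶠ[nhds x] (w ∘ φ.symm) ∘ φ := by
    filter_upwards [φ.open_source.mem_nhds hx] with y hy
    simp [φ.left_inv hy]
  have h5 := mfderiv_comp_apply x h3 h2 v
  rw [← h4.mfderiv_eq, mfderiv_eq_fderiv] at h5
  exact h5

end ChartDerivatives

section Metric

variable {m : ℕ} {M : Type*} [TopologicalSpace M] [ChartedSpace (EuclideanSpace ℝ (Fin m)) M]
  [IsManifold (𝓡 m) ∞ M]

theorem contMDiffOn_coordField (p : M) (i : Fin m) :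
    ContMDiffOn (𝓡 m) (𝓡 m).tangent ∞
      (fun z => (⟨(chartAt (EuclideanSpace ℝ (Fin m)) p).symm z, coordField p z i⟩ :
        TangentBundle (𝓡 m) M)) (chartAt (EuclideanSpace ℝ (Fin m)) p).target := by
  set φ := chartAt (EuclideanSpace ℝ (Fin m)) p
  have h1 : ContMDiffOn (𝓡 m) (𝓡 m) ∞ φ.symm φ.target := contMDiffOn_chart_symm
  have h2 := h1.contMDiffOn_tangentMapWithin (m := ∞) (by simp) φ.open_target.uniqueMDiffOn
  have h3 : ContMDiff (𝓡 m) (𝓡 m).tangent ∞ (fun z : EuclideanSpace ℝ (Fin m) =>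
      (⟨z, EuclideanSpace.single i (1 : ℝ)⟩ : TangentBundle (𝓡 m) (EuclideanSpace ℝ (Fin m)))) := by
    exact contMDiff_vectorSpace_iff_contDiff.2 contDiff_const
  refine (h2.comp h3.contMDiffOn (s := φ.target) fun z hz => hz).congr fun z hz => ?_
  simp only [Function.comp, tangentMapWithin]
  rw [mfderivWithin_of_isOpen φ.open_target hz]
  rfl

variable [RiemannianBundle (fun x : M => TangentSpace (𝓡 m) x)]

/-- `g_{ij}` is the Gram matrix of the coordinate fields, which are linearly independent. -/
theorem metricMatrix_det_pos {p : M} {z : EuclideanSpace ℝ (Fin m)}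
    (hz : z ∈ (chartAt (EuclideanSpace ℝ (Fin m)) p).target) : 0 < (metricMatrix p z).det := by
  change 0 < (Matrix.gram ℝ (coordField p z)).det
  refine (Matrix.posDef_gram_of_linearIndependent ?_).det_pos
  have h1 : LinearIndependent ℝ fun i : Fin m => EuclideanSpace.single i (1 : ℝ) := by
    have h2 := (EuclideanSpace.basisFun (Fin m) ℝ).toBasis.linearIndependent
    have h3 : ⇑(EuclideanSpace.basisFun (Fin m) ℝ).toBasis =
        fun i : Fin m => EuclideanSpace.single i (1 : ℝ) := by
      funext i
      simp
    rwa [h3] at h2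
  exact h1.map' (mfderiv (𝓡 m) (𝓡 m) (chartAt (EuclideanSpace ℝ (Fin m)) p).symm z).toLinearMap
    (LinearMap.ker_eq_bot.2 (mfderiv_chart_symm_bijective hz).1)

theorem contDiffOn_metricMatrix [IsContMDiffRiemannianBundle (𝓡 m) ∞ (EuclideanSpace ℝ (Fin m))
      (fun x : M => TangentSpace (𝓡 m) x)] (p : M) (i j : Fin m) :
    ContDiffOn ℝ ∞ (fun z => metricMatrix p z i j)
      (chartAt (EuclideanSpace ℝ (Fin m)) p).target := by
  rw [← contMDiffOn_iff_contDiffOn]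
  exact (contMDiffOn_coordField p i).inner_bundle (contMDiffOn_coordField p j)

end Metric

/-! ### The energy density -/

section Density

variable {m n q : ℕ} {M N : Type*}
  [TopologicalSpace M] [ChartedSpace (EuclideanSpace ℝ (Fin m)) M]
  [RiemannianBundle (fun x : M => TangentSpace (𝓡 m) x)]
  [TopologicalSpace N] [ChartedSpace (EuclideanSpace ℝ (Fin n)) N]
  [RiemannianBundle (fun y : N => TangentSpace (𝓡 n) y)]

/-- The energy density is `tr A³ / 6`, where `A` is the Gram matrix of the vectors `du(e_i)`. -/
theorem phiThreeDensity_eq_trace (u : M → N) (x : M) :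
    phiThreeDensity m n u x =
      (Matrix.gram ℝ (fun i => mfderiv (𝓡 m) (𝓡 n) u x (tangentFrame x i)) ^ 3).trace / 6 := by
  unfold phiThreeDensity dThree
  congr 1
  simp only [pow_succ, pow_zero, one_mul, Matrix.trace, Matrix.diag, Matrix.mul_apply,
    Matrix.gram_apply, sum_inner, real_inner_smul_left, Finset.sum_mul]
  refine Finset.sum_congr rfl fun i _ => ?_
  rw [Finset.sum_comm]

theorem IsIsometricImmersion.phiThreeDensity_eq_trace_euclidean
    {f : N → EuclideanSpace ℝ (Fin q)} (hf : IsIsometricImmersion n f) (u : M → N) (x : M) :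
    phiThreeDensity m n u x = (Matrix.gram ℝ (fun i =>
      euclideanDeriv f (u x) (mfderiv (𝓡 m) (𝓡 n) u x (tangentFrame x i))) ^ 3).trace / 6 := by
  rw [phiThreeDensity_eq_trace]
  have : Matrix.gram ℝ (fun i => mfderiv (𝓡 m) (𝓡 n) u x (tangentFrame x i)) =
    Matrix.gram ℝ (fun i =>
      euclideanDeriv f (u x) (mfderiv (𝓡 m) (𝓡 n) u x (tangentFrame x i))) := by
    ext i j
    rw [Matrix.gram_apply, Matrix.gram_apply, hf.2]
  rw [this]

/-- The energy density in the preferred chart at `p`: `tr (g⁻¹ C)³ / 6`, where `C` is the matrix of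
the first fundamental form of `f ∘ u`. -/
theorem IsIsometricImmersion.phiThreeDensity_chart [IsManifold (𝓡 m) ∞ M] [IsManifold (𝓡 n) ∞ N]
    {f : N → EuclideanSpace ℝ (Fin q)} (hf : IsIsometricImmersion n f) (u : M → N) (p : M)
    {z : EuclideanSpace ℝ (Fin m)} (hz : z ∈ (chartAt (EuclideanSpace ℝ (Fin m)) p).target)
    (hu : MDifferentiableAt (𝓡 m) (𝓡 n) u ((chartAt (EuclideanSpace ℝ (Fin m)) p).symm z)) :
    phiThreeDensity m n u ((chartAt (EuclideanSpace ℝ (Fin m)) p).symm z) =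
      (((metricMatrix p z)⁻¹ * Matrix.gram ℝ (fun k =>
        fderiv ℝ ((fun x => f (u x)) ∘ (chartAt (EuclideanSpace ℝ (Fin m)) p).symm) z
          (EuclideanSpace.single k (1 : ℝ)))) ^ 3).trace / 6 := by
  rw [hf.phiThreeDensity_eq_trace_euclidean]
  set x := (chartAt (EuclideanSpace ℝ (Fin m)) p).symm z with hx
  have hf' : MDifferentiableAt (𝓡 n) (𝓡 q) f (u x) := hf.1.mdifferentiableAt (by simp)
  have h := trace_gram_cube_eq (tangentFrame x) (coordField p z)
    ((euclideanDeriv f (u x)).toLinearMap ∘ₗ (mfderiv (𝓡 m) (𝓡 n) u x).toLinearMap)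
    (metricMatrix_det_pos hz).ne'
  have h2 : ∀ k, fderiv ℝ ((fun x => f (u x)) ∘ (chartAt (EuclideanSpace ℝ (Fin m)) p).symm) z
          (EuclideanSpace.single k (1 : ℝ)) =
        euclideanDeriv f (u x) (mfderiv (𝓡 m) (𝓡 n) u x (coordField p z k)) := by
    intro k
    rw [← euclideanDeriv_comp hf' hu]
    exact (euclideanDeriv_mfderiv_chart_symm p hz (hf'.comp x hu) _).symm
  simp only [h2]
  exact congrArg (· / 6) h

/-- The energy density of a smooth variation is smooth in time and space. The orthonormal frames
`tangentFrame` need not depend continuously on the point; the expression of the density in terms of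
`g⁻¹` does not involve them. -/
theorem IsIsometricImmersion.smoothFamily_phiThreeDensity [IsManifold (𝓡 m) ∞ M]
    [IsManifold (𝓡 n) ∞ N]
    [IsContMDiffRiemannianBundle (𝓡 m) ∞ (EuclideanSpace ℝ (Fin m))
      (fun x : M => TangentSpace (𝓡 m) x)]
    {f : N → EuclideanSpace ℝ (Fin q)} (hf : IsIsometricImmersion n f) {δ : ℝ} {U : ℝ → M → N}
    (hU : ContMDiffOn (𝓘(ℝ, ℝ).prod (𝓡 m)) (𝓡 n) ∞ (fun p : ℝ × M => U p.1 p.2)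
      (Ioo (-δ) δ ×ˢ (univ : Set M))) :
    SmoothFamily m δ (fun t => phiThreeDensity m n (U t)) := by
  have hw : SmoothFamily m δ (fun t x => f (U t x)) :=
    ContMDiffOn.smoothFamily (hf.1.comp_contMDiffOn hU)
  intro p
  set φ := chartAt (EuclideanSpace ℝ (Fin m)) p
  have hK : ∀ k : Fin m, ContDiffOn ℝ ∞ (fun s : ℝ × EuclideanSpace ℝ (Fin m) =>
      fderiv ℝ ((fun x => f (U s.1 x)) ∘ φ.symm) s.2 (EuclideanSpace.single k (1 : ℝ)))
      (Ioo (-δ) δ ×ˢ φ.target) := by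
    intro k
    have h1 := ((hw p).fderiv_of_isOpen (isOpen_timeChart δ p) (m := ∞) (by simp)).clm_apply
      (contDiffOn_const (c := ((0 : ℝ), EuclideanSpace.single k (1 : ℝ))))
    exact h1.congr fun s hs => hw.fderiv_slice p hs.1 hs.2 _
  have hC := fun k l => (hK k).inner ℝ (hK l)
  have hg : ∀ i j, ContDiffOn ℝ ∞ (fun s : ℝ × EuclideanSpace ℝ (Fin m) =>
      metricMatrix p s.2 i j) (Ioo (-δ) δ ×ˢ φ.target) := fun i j =>
    (contDiffOn_metricMatrix p i j).comp contDiff_snd.contDiffOn fun s hs => hs.2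
  have hA := ContDiffOn.matrix_mul (B := fun s : ℝ × EuclideanSpace ℝ (Fin m) =>
    Matrix.gram ℝ (fun k => fderiv ℝ ((fun x => f (U s.1 x)) ∘ φ.symm) s.2
      (EuclideanSpace.single k (1 : ℝ))))
    (ContDiffOn.matrix_inv hg fun s hs => (metricMatrix_det_pos hs.2).ne') hC
  have hA3 := ContDiffOn.matrix_mul (ContDiffOn.matrix_mul hA hA) hA
  have h2 := (ContDiffOn.sum (s := Finset.univ) fun i _ => hA3 i i).div_const 6
  refine h2.congr fun s hs => ?_
  have hu : MDifferentiableAt (𝓡 m) (𝓡 n) (U s.1) (φ.symm s.2) := by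
    have h3 : ContMDiffAt (𝓘(ℝ, ℝ).prod (𝓡 m)) (𝓡 n) ∞ (fun p : ℝ × M => U p.1 p.2)
        (s.1, φ.symm s.2) :=
      hU.contMDiffAt ((isOpen_Ioo.prod isOpen_univ).mem_nhds ⟨hs.1, mem_univ _⟩)
    have h4 : ContMDiffAt (𝓡 m) (𝓘(ℝ, ℝ).prod (𝓡 m)) ∞ (fun x : M => (s.1, x)) (φ.symm s.2) :=
      contMDiffAt_const.prodMk contMDiffAt_id
    exact (h3.comp (φ.symm s.2) h4).mdifferentiableAt (by simp)
  change phiThreeDensity m n (U s.1) (φ.symm s.2) = _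
  rw [hf.phiThreeDensity_chart (U s.1) p hs.2 hu]
  simp only [pow_succ, pow_zero, one_mul, Matrix.trace, Matrix.diag]
  rfl

end Density

/-! ### The Riemannian volume and differentiation under the integral sign -/

section VolumeMeasure

variable {m : ℕ} {M : Type*} [TopologicalSpace M] [ChartedSpace (EuclideanSpace ℝ (Fin m)) M]

section Partition

variable [IsManifold (𝓡 m) ∞ M] [T2Space M] [CompactSpace M]

theorem chartPartition_subset (p : M) :
    tsupport (chartPartition m M p) ⊆ (chartAt (EuclideanSpace ℝ (Fin m)) p).source :=
  Classical.choose_spec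
    (SmoothPartitionOfUnity.exists_isSubordinate_chartAt_source (I := 𝓡 m) (M := M)) p

theorem finite_chartPartition_ne_zero :
    {p : M | (Function.support (chartPartition m M p)).Nonempty}.Finite :=
  (chartPartition m M).locallyFinite.finite_nonempty_of_compact

end Partition

variable [RiemannianBundle (fun x : M => TangentSpace (𝓡 m) x)]

theorem chartVolume_apply [MeasurableSpace M] [BorelSpace M] (p : M) {A : Set M}
    (hA : MeasurableSet A) :
    chartVolume (m := m) p A =
      ∫⁻ z in (chartAt (EuclideanSpace ℝ (Fin m)) p).target ∩
        (chartAt (EuclideanSpace ℝ (Fin m)) p).symm ⁻¹' A,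
        ENNReal.ofReal (Real.sqrt (metricMatrix p z).det) := by
  set φ := chartAt (EuclideanSpace ℝ (Fin m)) p
  have h1 : AEMeasurable φ.symm ((volume : Measure (EuclideanSpace ℝ (Fin m))).restrict φ.target) :=
    φ.continuousOn_symm.aemeasurable φ.open_target.measurableSet
  rw [chartVolume, Measure.map_apply_of_aemeasurable
    (h1.mono_ac (withDensity_absolutelyContinuous _ _)) hA, withDensity_apply',
    Measure.restrict_restrict' φ.open_target.measurableSet, inter_comm]

variable [IsManifold (𝓡 m) ∞ M] [IsContMDiffRiemannianBundle (𝓡 m) ∞ (EuclideanSpace ℝ (Fin m))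
  (fun x : M => TangentSpace (𝓡 m) x)]

theorem continuousOn_sqrt_det (p : M) :
    ContinuousOn (fun z => Real.sqrt (metricMatrix p z).det)
      (chartAt (EuclideanSpace ℝ (Fin m)) p).target :=
  (ContDiffOn.matrix_det fun i j => contDiffOn_metricMatrix p i j).continuousOn.sqrt

variable [MeasurableSpace M] [BorelSpace M]

theorem chartVolume_pos (p : M) {A : Set M} (hA : IsOpen A)
    (hne : (A ∩ (chartAt (EuclideanSpace ℝ (Fin m)) p).source).Nonempty) :
    chartVolume (m := m) p A ≠ 0 := by
  set φ := chartAt (EuclideanSpace ℝ (Fin m)) p with hφ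
  have hopen : IsOpen (φ.target ∩ φ.symm ⁻¹' A) := φ.isOpen_inter_preimage_symm hA
  obtain ⟨x, hxA, hx⟩ := hne
  have hne' : (φ.target ∩ φ.symm ⁻¹' A).Nonempty :=
    ⟨φ x, φ.map_source hx, by simpa [φ.left_inv hx] using hxA⟩
  have hvol := hopen.measure_ne_zero (volume : Measure (EuclideanSpace ℝ (Fin m))) hne'
  rw [chartVolume_apply p hA.measurableSet, ← hφ]
  intro h0
  have hm : AEMeasurable (fun z => ENNReal.ofReal (Real.sqrt (metricMatrix p z).det))
      ((volume : Measure (EuclideanSpace ℝ (Fin m))).restrict (φ.target ∩ φ.symm ⁻¹' A)) :=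
    (((continuousOn_sqrt_det p).mono inter_subset_left).aemeasurable
      hopen.measurableSet).ennreal_ofReal
  rw [lintegral_eq_zero_iff' hm] at h0
  have h1 := (ae_restrict_iff' hopen.measurableSet).1 h0
  apply hvol
  refine measure_mono_null (fun z hz => ?_) h1
  simp only [mem_compl_iff, mem_ofPred_eq, Classical.not_imp]
  refine ⟨hz, ?_⟩
  simp only [Pi.zero_apply, ENNReal.ofReal_eq_zero, not_le]
  exact Real.sqrt_pos.2 (metricMatrix_det_pos hz.1)

theorem chartVolume_lt_top (p : M) {K : Set M} (hK : IsCompact K) (hKm : MeasurableSet K)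
    (hKs : K ⊆ (chartAt (EuclideanSpace ℝ (Fin m)) p).source) :
    chartVolume (m := m) p K < ⊤ := by
  set φ := chartAt (EuclideanSpace ℝ (Fin m)) p with hφ
  have himg : φ.target ∩ φ.symm ⁻¹' K = φ '' K := by
    rw [φ.image_eq_target_inter_inv_preimage hKs]
  rw [chartVolume_apply p hKm, ← hφ, himg]
  have hc : IsCompact (φ '' K) := hK.image_of_continuousOn (φ.continuousOn.mono hKs)
  have hsub : φ '' K ⊆ φ.target := by rw [← himg]; exact inter_subset_left
  exact (((continuousOn_sqrt_det p).mono hsub).integrableOn_compact hc).lintegral_lt_top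

variable [T2Space M] [CompactSpace M]

/-- Only finitely many functions of the partition of unity are nonzero, each has compact support in
its chart domain, and there the volume density is bounded. -/
instance isFiniteMeasure_riemannianVolume : IsFiniteMeasure (riemannianVolume m M) := by
  constructor
  rw [riemannianVolume, Measure.sum_apply _ MeasurableSet.univ]
  have hfin := finite_chartPartition_ne_zero (m := m) (M := M)
  rw [tsum_eq_sum (s := hfin.toFinset)]
  · refine ENNReal.sum_lt_top.2 fun p _ => ?_
    rw [withDensity_apply _ MeasurableSet.univ, Measure.restrict_univ]
    set K := tsupport (chartPartition m M p)
    have hK : IsClosed K := isClosed_tsupport _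
    refine lt_of_le_of_lt ?_ (chartVolume_lt_top p hK.isCompact hK.measurableSet
      (chartPartition_subset p))
    rw [← lintegral_indicator_one hK.measurableSet]
    refine lintegral_mono fun x => ?_
    by_cases hx : x ∈ K
    · rw [indicator_of_mem hx]
      exact ENNReal.ofReal_le_one.2 ((chartPartition m M).le_one p x)
    · have h0 : chartPartition m M p x = 0 := image_eq_zero_of_notMem_tsupport hx
      simp [h0]
  · intro p hp
    have h0 : ∀ x, chartPartition m M p x = 0 := by
      simpa [Set.not_nonempty_iff_eq_empty, Function.support_eq_empty_iff, funext_iff] using hp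
    simp [h0]

/-- Nonempty open sets have positive volume, since the volume density is positive in every chart. -/
instance isOpenPosMeasure_riemannianVolume : (riemannianVolume m M).IsOpenPosMeasure := by
  constructor
  rintro O hO ⟨x, hx⟩ h0
  obtain ⟨p, hp⟩ : ∃ p, 0 < chartPartition m M p x := by
    obtain ⟨p, hp⟩ := (chartPartition m M).exists_pos_of_mem (mem_univ x)
    exact ⟨p, hp⟩
  have hρ : Continuous (chartPartition m M p) := (chartPartition m M p).contMDiff.continuous
  have h1 : ((chartVolume (m := m) p).withDensity
      (fun x => ENNReal.ofReal (chartPartition m M p x))) O = 0 := by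
    rw [riemannianVolume, Measure.sum_apply _ hO.measurableSet, ENNReal.tsum_eq_zero] at h0
    exact h0 p
  rw [withDensity_apply_eq_zero' hρ.measurable.ennreal_ofReal.aemeasurable] at h1
  have hA : IsOpen ({x | 0 < chartPartition m M p x} ∩ O) :=
    (isOpen_lt continuous_const hρ).inter hO
  refine chartVolume_pos p hA ⟨x, ⟨hp, hx⟩, chartPartition_subset p (subset_tsupport _ hp.ne')⟩
    (measure_mono_null ?_ h1)
  rintro y hy
  refine ⟨?_, hy.2⟩
  have hy1 : 0 < chartPartition m M p y := hy.1
  simpa using hy1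

end VolumeMeasure

section ParametricIntegral

variable {m : ℕ} {M : Type*} [TopologicalSpace M] [ChartedSpace (EuclideanSpace ℝ (Fin m)) M]

theorem SmoothFamily.continuous_slice {δ : ℝ} {F : ℝ → M → ℝ} (hF : SmoothFamily m δ F) {t : ℝ}
    (ht : t ∈ Ioo (-δ) δ) : Continuous (F t) :=
  continuousOn_univ.1 <| hF.continuousOn.comp (f := fun x : M => (t, x))
    (continuous_const.prodMk continuous_id).continuousOn fun _ _ => ⟨ht, mem_univ _⟩

variable [CompactSpace M] [MeasurableSpace M] [BorelSpace M]

theorem SmoothFamily.integrable_slice {δ : ℝ} {F : ℝ → M → ℝ} (hF : SmoothFamily m δ F) {t : ℝ}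
    (ht : t ∈ Ioo (-δ) δ) (μ : Measure M) [IsFiniteMeasure μ] : Integrable (F t) μ := by
  have hc := hF.continuous_slice ht
  obtain ⟨C, hC⟩ := isCompact_univ.exists_bound_of_continuousOn hc.continuousOn
  exact Integrable.of_bound hc.aestronglyMeasurable C (Filter.Eventually.of_forall fun x =>
    hC x (mem_univ x))

/-- Differentiation under the integral sign over a compact manifold. -/
theorem SmoothFamily.hasDerivAt_integral {δ : ℝ} {F : ℝ → M → ℝ} (hF : SmoothFamily m δ F) {t : ℝ}
    (ht : t ∈ Ioo (-δ) δ) (μ : Measure M) [IsFiniteMeasure μ] :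
    HasDerivAt (fun s => ∫ x, F s x ∂μ) (∫ x, timeDeriv F t x ∂μ) t := by
  obtain ⟨a, b, hab, hsub⟩ : ∃ a b, t ∈ Ioo a b ∧ Icc a b ⊆ Ioo (-δ) δ :=
    ⟨(t - δ) / 2, (t + δ) / 2, ⟨by linarith [ht.1, ht.2], by linarith [ht.1, ht.2]⟩,
      fun s hs => ⟨by linarith [hs.1, ht.1], by linarith [hs.2, ht.2]⟩⟩
  obtain ⟨C, hC⟩ := (isCompact_Icc.prod isCompact_univ).exists_bound_of_continuousOn
    (hF.smoothFamily_timeDeriv.continuousOn.mono (prod_mono hsub subset_rfl))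
  have hnhds : Ioo a b ∈ nhds t := isOpen_Ioo.mem_nhds hab
  refine (hasDerivAt_integral_of_dominated_loc_of_deriv_le (bound := fun _ => C) hnhds ?_
    (hF.integrable_slice ht μ)
    (hF.smoothFamily_timeDeriv.continuous_slice ht).aestronglyMeasurable ?_
    (integrable_const C) ?_).2
  · filter_upwards [hnhds] with s hs
    exact (hF.continuous_slice (hsub (Ioo_subset_Icc_self hs))).aestronglyMeasurable
  · exact Filter.Eventually.of_forall fun x s hs =>
      hC (s, x) ⟨Ioo_subset_Icc_self hs, mem_univ x⟩
  · exact Filter.Eventually.of_forall fun x s hs =>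
      hF.hasDerivAt (hsub (Ioo_subset_Icc_self hs)) x

theorem SmoothFamily.iteratedDeriv_two_integral {δ : ℝ} (hδ : 0 < δ) {F : ℝ → M → ℝ}
    (hF : SmoothFamily m δ F) (μ : Measure M) [IsFiniteMeasure μ] :
    iteratedDeriv 2 (fun s => ∫ x, F s x ∂μ) 0 = ∫ x, timeDeriv (timeDeriv F) 0 x ∂μ := by
  have h0 : (0 : ℝ) ∈ Ioo (-δ) δ := ⟨by linarith, hδ⟩
  rw [iteratedDeriv_succ, iteratedDeriv_one]
  have h1 : deriv (fun s => ∫ x, F s x ∂μ) =ᶠ[nhds 0] fun s => ∫ x, timeDeriv F s x ∂μ := by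
    filter_upwards [isOpen_Ioo.mem_nhds h0] with s hs
    exact (hF.hasDerivAt_integral hs μ).deriv
  rw [h1.deriv_eq]
  exact (hF.smoothFamily_timeDeriv.hasDerivAt_integral h0 μ).deriv

end ParametricIntegral

/-! ### The tangential projection and deformations of the identity -/

noncomputable section PseudoInverse

variable {E F : Type*} [NormedAddCommGroup E] [InnerProductSpace ℝ E] [FiniteDimensional ℝ E]
  [NormedAddCommGroup F] [InnerProductSpace ℝ F] [FiniteDimensional ℝ F]

/-- The Moore–Penrose inverse `(L†L)⁻¹L†` of an injective linear map `L` (and `0` if `L` is not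
injective). It serves to express orthogonal projections to the range of `L` smoothly in `L`. -/
def pseudoInverse (L : E →L[ℝ] F) : F →L[ℝ] E :=
  (L.adjoint ∘L L).inverse ∘L L.adjoint

theorem isInvertible_adjoint_comp_self {L : E →L[ℝ] F} (hL : Function.Injective L) :
    (L.adjoint ∘L L).IsInvertible := by
  have hinj : Function.Injective (L.adjoint ∘L L : E →L[ℝ] E).toLinearMap := by
    rw [← LinearMap.ker_eq_bot, LinearMap.ker_eq_bot']
    intro x hx
    have h1 : inner ℝ (L.adjoint (L x)) x = (0 : ℝ) := by
      have : L.adjoint (L x) = 0 := hx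
      rw [this, inner_zero_left]
    rw [ContinuousLinearMap.adjoint_inner_left, inner_self_eq_zero] at h1
    exact hL (by simpa using h1)
  exact ⟨(LinearEquiv.ofInjectiveEndo _ hinj).toContinuousLinearEquiv, by ext; rfl⟩

theorem apply_pseudoInverse {L : E →L[ℝ] F} (hL : Function.Injective L) (x : F) :
    L (pseudoInverse L x) = (LinearMap.range L.toLinearMap).starProjection x := by
  refine (Submodule.eq_starProjection_of_mem_of_inner_eq_zero
    (LinearMap.mem_range_self L.toLinearMap (pseudoInverse L x)) ?_).symm
  rintro _ ⟨w, rfl⟩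
  have h1 : L.adjoint (L (pseudoInverse L x)) = L.adjoint x :=
    (isInvertible_adjoint_comp_self hL).self_apply_inverse (L.adjoint x)
  change inner ℝ (x - L (pseudoInverse L x)) (L w) = 0
  rw [← ContinuousLinearMap.adjoint_inner_left, map_sub, h1, sub_self, inner_zero_left]

theorem contDiff_adjoint {r : WithTop ℕ∞} :
    ContDiff ℝ r (fun L : E →L[ℝ] F => L.adjoint) := by
  have : IsBoundedLinearMap ℝ (fun L : E →L[ℝ] F => L.adjoint) :=
    ⟨⟨fun a b => map_add _ a b, fun c a => by simp⟩, 1, one_pos, fun a => by simp⟩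
  exact this.contDiff

theorem ContDiffOn.pseudoInverse {X : Type*} [NormedAddCommGroup X] [NormedSpace ℝ X]
    {r : WithTop ℕ∞} {s : Set X} {L : X → E →L[ℝ] F} (hL : ContDiffOn ℝ r L s)
    (hinj : ∀ x ∈ s, Function.Injective (L x)) :
    ContDiffOn ℝ r (fun x => pseudoInverse (L x)) s := by
  have h1 : ContDiffOn ℝ r (fun x => (L x).adjoint) s := contDiff_adjoint.comp_contDiffOn hL
  have h2 : ContDiffOn ℝ r (fun x => ((L x).adjoint ∘L L x).inverse) s := fun x hx =>
    ContDiffAt.comp_contDiffWithinAt (g := ContinuousLinearMap.inverse) x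
      (isInvertible_adjoint_comp_self (hinj x hx)).contDiffAt_map_inverse ((h1.clm_comp hL) x hx)
  exact h2.clm_comp h1

end PseudoInverse

noncomputable section TangentialProjection

variable {n q : ℕ} {N : Type*} [TopologicalSpace N] [ChartedSpace (EuclideanSpace ℝ (Fin n)) N]

/-- The orthogonal projection of `ℝ^q` onto the tangent space of the immersion `f` at `y`. -/
def tangentProj (f : N → EuclideanSpace ℝ (Fin q)) (y : N) :
    EuclideanSpace ℝ (Fin q) →L[ℝ] EuclideanSpace ℝ (Fin q) :=
  (LinearMap.range (euclideanDeriv (n := n) f y).toLinearMap).starProjection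

variable [RiemannianBundle (fun y : N => TangentSpace (𝓡 n) y)]
  {f : N → EuclideanSpace ℝ (Fin q)}

theorem IsIsometricImmersion.injective (hf : IsIsometricImmersion n f) (y : N) :
    Function.Injective (euclideanDeriv (n := n) f y) := by
  rw [injective_iff_map_eq_zero]
  intro v hv
  have := hf.2 y v v
  rw [hv, inner_zero_left] at this
  exact inner_self_eq_zero.1 this.symm

theorem IsIsometricImmersion.mdifferentiableAt (hf : IsIsometricImmersion n f) (y : N) :
    MDifferentiableAt (𝓡 n) (𝓡 q) f y := hf.1.mdifferentiableAt (by simp)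

variable [IsManifold (𝓡 n) ∞ N]

theorem IsIsometricImmersion.injective_chart (hf : IsIsometricImmersion n f) (p : N)
    {z : EuclideanSpace ℝ (Fin n)} (hz : z ∈ (chartAt (EuclideanSpace ℝ (Fin n)) p).target) :
    Function.Injective (fderiv ℝ (f ∘ (chartAt (EuclideanSpace ℝ (Fin n)) p).symm) z) := by
  have h := (hf.injective _).comp (mfderiv_chart_symm_bijective hz).1
  intro a b hab
  apply h
  simp only [Function.comp]
  rw [euclideanDeriv_mfderiv_chart_symm p hz (hf.mdifferentiableAt _),
    euclideanDeriv_mfderiv_chart_symm p hz (hf.mdifferentiableAt _), hab]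

theorem IsIsometricImmersion.tangentProj_chart (hf : IsIsometricImmersion n f) (p : N)
    {z : EuclideanSpace ℝ (Fin n)} (hz : z ∈ (chartAt (EuclideanSpace ℝ (Fin n)) p).target)
    (a : EuclideanSpace ℝ (Fin q)) :
    tangentProj (n := n) f ((chartAt (EuclideanSpace ℝ (Fin n)) p).symm z) a =
      fderiv ℝ (f ∘ (chartAt (EuclideanSpace ℝ (Fin n)) p).symm) z
        (pseudoInverse (fderiv ℝ (f ∘ (chartAt (EuclideanSpace ℝ (Fin n)) p).symm) z) a) := by
  rw [apply_pseudoInverse (hf.injective_chart p hz), tangentProj]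
  have h : LinearMap.range (euclideanDeriv (n := n) f
      ((chartAt (EuclideanSpace ℝ (Fin n)) p).symm z)).toLinearMap =
      LinearMap.range
        (fderiv ℝ (f ∘ (chartAt (EuclideanSpace ℝ (Fin n)) p).symm) z).toLinearMap := by
    ext b
    constructor
    · rintro ⟨v, rfl⟩
      obtain ⟨ξ, rfl⟩ := (mfderiv_chart_symm_bijective hz).2 v
      exact ⟨ξ, (euclideanDeriv_mfderiv_chart_symm p hz (hf.mdifferentiableAt _) ξ).symm⟩
    · rintro ⟨ξ, rfl⟩
      exact ⟨_, euclideanDeriv_mfderiv_chart_symm p hz (hf.mdifferentiableAt _) ξ⟩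
  simp only [h]

theorem IsIsometricImmersion.contDiffOn_fderiv_chart (hf : IsIsometricImmersion n f) (p : N) :
    ContDiffOn ℝ ∞ (fderiv ℝ (f ∘ (chartAt (EuclideanSpace ℝ (Fin n)) p).symm))
      (chartAt (EuclideanSpace ℝ (Fin n)) p).target :=
  (hf.1.smoothInCharts p).fderiv_of_isOpen
    (chartAt (EuclideanSpace ℝ (Fin n)) p).open_target (by simp)

theorem IsIsometricImmersion.smoothInCharts_tangentProj (hf : IsIsometricImmersion n f) :
    SmoothInCharts n (tangentProj (n := n) f) := by
  intro p
  have h1 := hf.contDiffOn_fderiv_chart p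
  refine (h1.clm_comp (h1.pseudoInverse fun z hz => hf.injective_chart p hz)).congr fun z hz => ?_
  ext1 a
  exact hf.tangentProj_chart p hz a

end TangentialProjection

section Variations

variable {n q : ℕ} {N : Type*} [TopologicalSpace N] [ChartedSpace (EuclideanSpace ℝ (Fin n)) N]

/-- `Ψ t`, `|t| < δ`, is a smooth family of self-maps of `N` that starts at the identity with the
velocity field `Z`, regarded as a map to `ℝ^q` by means of `f`. -/
structure IsDeformation (n : ℕ) {q : ℕ} {N : Type*} [TopologicalSpace N]
    [ChartedSpace (EuclideanSpace ℝ (Fin n)) N] (f Z : N → EuclideanSpace ℝ (Fin q)) (δ : ℝ)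
    (Ψ : ℝ → N → N) : Prop where
  pos : 0 < δ
  zero : ∀ y, Ψ 0 y = y
  smooth : ContMDiffOn (𝓘(ℝ, ℝ).prod (𝓡 n)) (𝓡 n) ∞ (fun s : ℝ × N => Ψ s.1 s.2)
    (Ioo (-δ) δ ×ˢ (univ : Set N))
  velocity : ∀ y, HasDerivAt (fun t => f (Ψ t y)) (Z y) 0

theorem ContMDiffOn.contMDiffAt_time {δ : ℝ} {Ψ : ℝ → N → N}
    (h : ContMDiffOn (𝓘(ℝ, ℝ).prod (𝓡 n)) (𝓡 n) ∞ (fun s : ℝ × N => Ψ s.1 s.2)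
      (Ioo (-δ) δ ×ˢ (univ : Set N))) {t : ℝ} (ht : t ∈ Ioo (-δ) δ) (y : N) :
    ContMDiffAt 𝓘(ℝ, ℝ) (𝓡 n) ∞ (fun t => Ψ t y) t := by
  have h1 := h.contMDiffAt (x := (t, y)) ((isOpen_Ioo.prod isOpen_univ).mem_nhds ⟨ht, mem_univ _⟩)
  exact h1.comp t (contMDiffAt_id.prodMk contMDiffAt_const)

theorem IsDeformation.zero_mem {f Z : N → EuclideanSpace ℝ (Fin q)} {δ : ℝ} {Ψ : ℝ → N → N}
    (h : IsDeformation n f Z δ Ψ) : (0 : ℝ) ∈ Ioo (-δ) δ :=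
  ⟨neg_lt_zero.2 h.pos, h.pos⟩

theorem IsDeformation.eventually_mem_source {f Z : N → EuclideanSpace ℝ (Fin q)} {δ : ℝ}
    {Ψ : ℝ → N → N} (h : IsDeformation n f Z δ Ψ) (y : N) :
    ∀ᶠ t in nhds (0 : ℝ), Ψ t y ∈ (chartAt (EuclideanSpace ℝ (Fin n)) y).source := by
  refine (h.smooth.contMDiffAt_time h.zero_mem y).continuousAt.eventually_mem ?_
  rw [h.zero]
  exact (chartAt (EuclideanSpace ℝ (Fin n)) y).open_source.mem_nhds (mem_chart_source _ y)

theorem IsDeformation.id (f : N → EuclideanSpace ℝ (Fin q)) :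
    IsDeformation n f (fun _ => 0) 1 (fun _ y => y) where
  pos := one_pos
  zero _ := rfl
  smooth := contMDiffOn_snd
  velocity _ := hasDerivAt_const _ _

variable [IsManifold (𝓡 n) ∞ N]

namespace IsDeformation

variable {f Z Z' : N → EuclideanSpace ℝ (Fin q)} {δ δ' : ℝ} {Ψ Ψ' : ℝ → N → N}

/-- The trajectory of a point in the preferred chart at this point. -/
theorem contDiffAt_chart (h : IsDeformation n f Z δ Ψ) (y : N) :
    ContDiffAt ℝ ∞ (fun t => chartAt (EuclideanSpace ℝ (Fin n)) y (Ψ t y)) 0 := by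
  rw [← contMDiffAt_iff_contDiffAt]
  refine ContMDiffAt.comp 0 ?_ (h.smooth.contMDiffAt_time h.zero_mem y)
  rw [h.zero]
  exact contMDiffOn_chart.contMDiffAt ((chartAt (EuclideanSpace ℝ (Fin n)) y).open_source.mem_nhds
    (mem_chart_source _ y))

theorem smoothFamily (h : IsDeformation n f Z δ Ψ) (hf : ContMDiff (𝓡 n) (𝓡 q) ∞ f) :
    SmoothFamily n δ (fun t y => f (Ψ t y)) :=
  ContMDiffOn.smoothFamily (hf.comp_contMDiffOn h.smooth)

/-- In the chart at `y`, the velocity is the image of the coordinate velocity. -/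
theorem velocity_chart (h : IsDeformation n f Z δ Ψ) (hf : ContMDiff (𝓡 n) (𝓡 q) ∞ f) (y : N) :
    fderiv ℝ (f ∘ (chartAt (EuclideanSpace ℝ (Fin n)) y).symm)
      (chartAt (EuclideanSpace ℝ (Fin n)) y y)
      (deriv (fun t => chartAt (EuclideanSpace ℝ (Fin n)) y (Ψ t y)) 0) = Z y := by
  set φ := chartAt (EuclideanSpace ℝ (Fin n)) y
  have h1 := ((h.contDiffAt_chart y).differentiableAt (by simp)).hasDerivAt
  have h2 : DifferentiableAt ℝ (f ∘ φ.symm) (φ (Ψ 0 y)) := by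
    rw [h.zero]
    exact ((hf.smoothInCharts y).contDiffAt
      (φ.open_target.mem_nhds (mem_chart_target _ y))).differentiableAt (by simp)
  have h3 := h2.hasFDerivAt.comp_hasDerivAt 0 h1
  rw [h.zero] at h3
  refine h3.unique ((h.velocity y).congr_of_eventuallyEq ?_)
  filter_upwards [h.eventually_mem_source y] with t ht
  simp only [Function.comp]
  rw [φ.left_inv ht]

/-- Composing deformations adds their velocities. -/
theorem comp (h : IsDeformation n f Z δ Ψ) (h' : IsDeformation n f Z' δ' Ψ')
    (hf : ContMDiff (𝓡 n) (𝓡 q) ∞ f) :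
    IsDeformation n f (fun y => Z y + Z' y) (min δ δ') (fun t y => Ψ t (Ψ' t y)) where
  pos := lt_min h.pos h'.pos
  zero y := by rw [h'.zero, h.zero]
  smooth := by
    have hs : Ioo (-min δ δ') (min δ δ') ⊆ Ioo (-δ) δ ∩ Ioo (-δ') δ' := fun t ht =>
      ⟨⟨by linarith [ht.1, min_le_left δ δ'], by linarith [ht.2, min_le_left δ δ']⟩,
        ⟨by linarith [ht.1, min_le_right δ δ'], by linarith [ht.2, min_le_right δ δ']⟩⟩
    have h1 : ContMDiffOn (𝓘(ℝ, ℝ).prod (𝓡 n)) (𝓘(ℝ, ℝ).prod (𝓡 n)) ∞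
        (fun s : ℝ × N => (s.1, Ψ' s.1 s.2))
        (Ioo (-min δ δ') (min δ δ') ×ˢ (univ : Set N)) :=
      contMDiffOn_fst.prodMk (h'.smooth.mono (prod_mono (fun t ht => (hs ht).2) subset_rfl))
    exact h.smooth.comp h1 fun s hs' => ⟨(hs hs'.1).1, mem_univ _⟩
  velocity y := by
    set φ := chartAt (EuclideanSpace ℝ (Fin n)) y with hφ
    have hy : φ y ∈ φ.target := mem_chart_target _ y
    have hγ := ((h'.contDiffAt_chart y).differentiableAt (by simp)).hasDerivAt
    set ξ := deriv (fun t => φ (Ψ' t y)) 0 with hξ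
    have hH := h.smoothFamily hf
    have h1 := ((hH.contDiffAt y h.zero_mem hy).differentiableAt (by simp)).hasFDerivAt
    have h2 : HasDerivAt (fun t => (t, φ (Ψ' t y))) ((1 : ℝ), ξ) 0 := (hasDerivAt_id 0).prodMk hγ
    have h0 : φ y = φ (Ψ' 0 y) := by rw [h'.zero]
    have h3 := HasFDerivAt.comp_hasDerivAt (x := (0 : ℝ)) (f := fun t => (t, φ (Ψ' t y)))
      (l := fun s : ℝ × EuclideanSpace ℝ (Fin n) => f (Ψ s.1 (φ.symm s.2)))
      (by rw [← h0]; exact h1) h2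
    -- The time direction contributes `Z`, the space direction `df ξ = Z'`.
    have hsum : ((1 : ℝ), ξ) = (1, 0) + (0, ξ) := by simp
    rw [hsum, map_add] at h3
    have hb : (fun x => f (Ψ 0 x)) = f := by
      funext x
      rw [h.zero]
    have e1 := hH.timeDeriv_chart y h.zero_mem hy
    have e2 := hH.fderiv_slice y h.zero_mem hy ξ
    rw [← hφ] at e1 e2
    rw [hb, hξ, h'.velocity_chart hf y] at e2
    rw [φ.left_inv (mem_chart_source _ y)] at e1
    have e3 : timeDeriv (fun t y => f (Ψ t y)) 0 y = Z y := (h.velocity y).deriv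
    rw [e3] at e1
    rw [← hξ] at e2
    rw [← e1, ← e2] at h3
    refine h3.congr_of_eventuallyEq ?_
    filter_upwards [h'.eventually_mem_source y] with t ht
    simp only [Function.comp]
    rw [φ.left_inv ht]

end IsDeformation

theorem exists_isDeformation_sum {f : N → EuclideanSpace ℝ (Fin q)}
    (hf : ContMDiff (𝓡 n) (𝓡 q) ∞ f) {ι : Type*} (s : Finset ι)
    (Z : ι → N → EuclideanSpace ℝ (Fin q)) (hZ : ∀ i ∈ s, ∃ δ Ψ, IsDeformation n f (Z i) δ Ψ) :
    ∃ δ Ψ, IsDeformation n f (fun y => ∑ i ∈ s, Z i y) δ Ψ := by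
  classical
  induction s using Finset.induction_on with
  | empty => exact ⟨1, _, by simpa using IsDeformation.id f⟩
  | insert a s ha ih =>
    obtain ⟨δ, Ψ, h⟩ := ih fun i hi => hZ i (Finset.mem_insert_of_mem hi)
    obtain ⟨δ', Ψ', h'⟩ := hZ a (Finset.mem_insert_self a s)
    exact ⟨_, _, by simpa only [Finset.sum_insert ha] using h'.comp h hf⟩

end Variations

/-! ### Existence of deformations with given velocity -/

section ChartDeformation

variable {n q : ℕ} {N : Type*} [TopologicalSpace N] [ChartedSpace (EuclideanSpace ℝ (Fin n)) N]
  [IsManifold (𝓡 n) ∞ N] [CompactSpace N]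

/-- A vector field that is supported in a chart is the velocity of a deformation: in the chart, move
along straight lines. -/
theorem exists_isDeformation_of_chart {f : N → EuclideanSpace ℝ (Fin q)}
    (hf : ContMDiff (𝓡 n) (𝓡 q) ∞ f) (p : N) {ρ : N → ℝ} (hρ : ContMDiff (𝓡 n) 𝓘(ℝ, ℝ) ∞ ρ)
    (hsupp : tsupport ρ ⊆ (chartAt (EuclideanSpace ℝ (Fin n)) p).source)
    {ξ : EuclideanSpace ℝ (Fin n) → EuclideanSpace ℝ (Fin n)}
    (hξ : ContDiffOn ℝ ∞ ξ (chartAt (EuclideanSpace ℝ (Fin n)) p).target)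
    {Z : N → EuclideanSpace ℝ (Fin q)}
    (hZ : ∀ y ∈ (chartAt (EuclideanSpace ℝ (Fin n)) p).source,
      fderiv ℝ (f ∘ (chartAt (EuclideanSpace ℝ (Fin n)) p).symm)
        (chartAt (EuclideanSpace ℝ (Fin n)) p y)
        (ξ (chartAt (EuclideanSpace ℝ (Fin n)) p y)) = Z y) :
    ∃ δ Ψ, IsDeformation n f (fun y => ρ y • Z y) δ Ψ := by
  classical
  set φ := chartAt (EuclideanSpace ℝ (Fin n)) p with hφ
  set K := tsupport ρ
  have hK : IsCompact K := (isClosed_tsupport ρ).isCompact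
  have hρ0 : ∀ y, y ∉ K → ρ y = 0 := fun y hy => image_eq_zero_of_notMem_tsupport hy
  let σ : ℝ × N → EuclideanSpace ℝ (Fin n) := fun s => φ s.2 + s.1 • ρ s.2 • ξ (φ s.2)
  have hσ : ContMDiffOn (𝓘(ℝ, ℝ).prod (𝓡 n)) (𝓡 n) ∞ σ (univ ×ˢ φ.source) := by
    have h1 : ContMDiffOn (𝓘(ℝ, ℝ).prod (𝓡 n)) (𝓡 n) ∞ (fun s : ℝ × N => φ s.2)
        (univ ×ˢ φ.source) :=
      (contMDiffOn_chart (I := 𝓡 n) (x := p)).comp contMDiffOn_snd fun s hs => hs.2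
    have h2 : ContMDiffOn (𝓘(ℝ, ℝ).prod (𝓡 n)) (𝓡 n) ∞ (fun s : ℝ × N => ξ (φ s.2))
        (univ ×ˢ φ.source) :=
      hξ.contMDiffOn.comp h1 fun s hs => φ.map_source hs.2
    exact h1.add (contMDiffOn_fst.smul ((hρ.comp_contMDiffOn contMDiffOn_snd).smul h2))
  have hopen : IsOpen ((univ : Set ℝ) ×ˢ φ.source) := isOpen_univ.prod φ.open_source
  obtain ⟨δ, hδ, hδK⟩ : ∃ δ > 0, ∀ t ∈ Ioo (-δ) δ, ∀ y ∈ K, σ (t, y) ∈ φ.target := by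
    have h1 : ∀ᶠ t in nhds (0 : ℝ), ∀ y ∈ K, σ (t, y) ∈ φ.target := by
      refine hK.eventually_forall_of_forall_eventually (P := fun t y => σ (t, y) ∈ φ.target)
        fun y hy => ?_
      have hc : ContinuousAt σ (0, y) :=
        hσ.continuousOn.continuousAt (hopen.mem_nhds ⟨mem_univ _, hsupp hy⟩)
      refine hc.eventually_mem (φ.open_target.mem_nhds ?_)
      simpa [σ] using φ.map_source (hsupp hy)
    obtain ⟨δ, hδ, h2⟩ := Metric.eventually_nhds_iff_ball.1 h1
    refine ⟨δ, hδ, fun t ht => h2 t ?_⟩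
    rwa [Real.ball_eq_Ioo, zero_sub, zero_add]
  have htarget : ∀ t ∈ Ioo (-δ) δ, ∀ y ∈ φ.source, σ (t, y) ∈ φ.target := by
    intro t ht y hy
    by_cases hyK : y ∈ K
    · exact hδK t ht y hyK
    · simpa [σ, hρ0 y hyK] using φ.map_source hy
  -- Nothing moves off the support of `ρ`, so that this is smooth across the boundary of the chart.
  let Ψ : ℝ → N → N := fun t y => if y ∈ φ.source then φ.symm (σ (t, y)) else y
  refine ⟨δ, Ψ, hδ, fun y => ?_, ?_, fun y => ?_⟩
  · by_cases hy : y ∈ φ.source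
    · simp [Ψ, hy, σ, φ.left_inv hy]
    · simp [Ψ, hy]
  · rintro ⟨t, y⟩ ⟨ht, -⟩
    apply ContMDiffAt.contMDiffWithinAt
    by_cases hy : y ∈ φ.source
    · have h1 : ContMDiffAt (𝓘(ℝ, ℝ).prod (𝓡 n)) (𝓡 n) ∞ (φ.symm ∘ σ) (t, y) :=
        ((contMDiffOn_chart_symm (I := 𝓡 n) (x := p)).contMDiffAt
          (φ.open_target.mem_nhds (htarget t ht y hy))).comp (t, y)
          (hσ.contMDiffAt (hopen.mem_nhds ⟨mem_univ _, hy⟩))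
      refine h1.congr_of_eventuallyEq ?_
      filter_upwards [hopen.mem_nhds (show (t, y) ∈ (univ : Set ℝ) ×ˢ φ.source from
        ⟨mem_univ _, hy⟩)] with s hs
      simp [Ψ, hs.2]
    · have hyK : y ∉ K := fun h => hy (hsupp h)
      refine (contMDiffAt_snd (I := 𝓘(ℝ, ℝ)) (J := 𝓡 n) (n := ∞)
        (p := (t, y))).congr_of_eventuallyEq ?_
      have hKo : IsOpen ((univ : Set ℝ) ×ˢ Kᶜ) :=
        isOpen_univ.prod (isClosed_tsupport ρ).isOpen_compl
      filter_upwards [hKo.mem_nhds (show (t, y) ∈ (univ : Set ℝ) ×ˢ Kᶜ from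
        ⟨mem_univ _, hyK⟩)] with s hs
      by_cases hs' : s.2 ∈ φ.source
      · simp [Ψ, hs', σ, hρ0 s.2 hs.2, φ.left_inv hs']
      · simp [Ψ, hs']
  · by_cases hy : y ∈ φ.source
    · have hd : DifferentiableAt ℝ (f ∘ φ.symm) (φ y) :=
        ((hf.smoothInCharts p).contDiffAt
          (φ.open_target.mem_nhds (φ.map_source hy))).differentiableAt (by simp)
      have h1 : HasDerivAt (fun t : ℝ => φ y + t • ρ y • ξ (φ y)) (ρ y • ξ (φ y)) 0 := by
        simpa using ((hasDerivAt_id (0 : ℝ)).smul_const (ρ y • ξ (φ y))).const_add (φ y)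
      have h2 := HasFDerivAt.comp_hasDerivAt (x := (0 : ℝ))
        (f := fun t : ℝ => φ y + t • ρ y • ξ (φ y)) (l := f ∘ φ.symm)
        (by simpa using hd.hasFDerivAt) h1
      rw [map_smul, hZ y hy] at h2
      refine h2.congr_of_eventuallyEq (Filter.Eventually.of_forall fun t => ?_)
      simp [Ψ, hy, σ]
    · have h0 : ρ y = 0 := hρ0 y fun h => hy (hsupp h)
      simpa [Ψ, hy, h0] using hasDerivAt_const (0 : ℝ) (f y)

/-- Every smooth tangential vector field of an immersed compact manifold is the velocity of a
deformation. -/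
theorem IsIsometricImmersion.exists_isDeformation [T2Space N]
    [RiemannianBundle (fun y : N => TangentSpace (𝓡 n) y)] {f : N → EuclideanSpace ℝ (Fin q)}
    (hf : IsIsometricImmersion n f) {c : N → EuclideanSpace ℝ (Fin q)} (hc : SmoothInCharts n c) :
    ∃ δ Ψ, IsDeformation n f (fun y => tangentProj (n := n) f y (c y)) δ Ψ := by
  have hfin := finite_chartPartition_ne_zero (m := n) (M := N)
  obtain ⟨δ, Ψ, h⟩ := exists_isDeformation_sum hf.1 hfin.toFinset
    (fun p y => chartPartition n N p y • tangentProj (n := n) f y (c y)) (fun p _ => by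
      refine exists_isDeformation_of_chart hf.1 p (chartPartition n N p).contMDiff
        (chartPartition_subset p)
        (((hf.contDiffOn_fderiv_chart p).pseudoInverse fun z hz =>
          hf.injective_chart p hz).clm_apply (hc p)) fun y hy => ?_
      have h1 := hf.tangentProj_chart p
        ((chartAt (EuclideanSpace ℝ (Fin n)) p).map_source hy) (c y)
      rw [(chartAt (EuclideanSpace ℝ (Fin n)) p).left_inv hy] at h1
      rw [h1, Function.comp, (chartAt (EuclideanSpace ℝ (Fin n)) p).left_inv hy])
  refine ⟨δ, Ψ, ?_⟩
  have hsum : (fun y => ∑ p ∈ hfin.toFinset,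
      chartPartition n N p y • tangentProj (n := n) f y (c y)) =
      fun y => tangentProj (n := n) f y (c y) := by
    funext y
    rw [← Finset.sum_smul]
    have h1 := (chartPartition n N).sum_eq_one (mem_univ y)
    rw [finsum_eq_sum_of_support_subset (s := hfin.toFinset)] at h1
    · rw [h1, one_smul]
    · intro p hp
      simp only [Finite.coe_toFinset]
      exact ⟨y, hp⟩
  rwa [hsum] at h

end ChartDeformation

/-! ### The derivative of the tangential projection and the second fundamental form -/

noncomputable section SpaceDerivative

variable {n q : ℕ} {N : Type*} [TopologicalSpace N] [ChartedSpace (EuclideanSpace ℝ (Fin n)) N]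
  {E : Type*} [NormedAddCommGroup E] [NormedSpace ℝ E]

/-- The differential at `y` of the preferred chart at `y`, with values in `ℝ^n`. -/
def chartDifferential (n : ℕ) {N : Type*} [TopologicalSpace N]
    [ChartedSpace (EuclideanSpace ℝ (Fin n)) N] (y : N) :
    TangentSpace (𝓡 n) y →L[ℝ] EuclideanSpace ℝ (Fin n) :=
  mfderiv (𝓡 n) (𝓡 n) (chartAt (EuclideanSpace ℝ (Fin n)) y) y

/-- The differential at `y` of a map from `N` to a normed space, computed in the preferred chart at
`y`. -/
def spaceDeriv (n : ℕ) {N E : Type*} [TopologicalSpace N]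
    [ChartedSpace (EuclideanSpace ℝ (Fin n)) N] [NormedAddCommGroup E] [NormedSpace ℝ E]
    (c : N → E) (y : N) : TangentSpace (𝓡 n) y →L[ℝ] E :=
  (fderiv ℝ (c ∘ (chartAt (EuclideanSpace ℝ (Fin n)) y).symm)
    (chartAt (EuclideanSpace ℝ (Fin n)) y y)).comp (chartDifferential n y)

theorem spaceDeriv_apply (c : N → E) (y : N) (v : TangentSpace (𝓡 n) y) :
    spaceDeriv n c y v = fderiv ℝ (c ∘ (chartAt (EuclideanSpace ℝ (Fin n)) y).symm)
      (chartAt (EuclideanSpace ℝ (Fin n)) y y) (chartDifferential n y v) := rfl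

theorem SmoothInCharts.hasFDerivAt {c : N → E} (hc : SmoothInCharts n c) (y : N) :
    HasFDerivAt (c ∘ (chartAt (EuclideanSpace ℝ (Fin n)) y).symm)
      (fderiv ℝ (c ∘ (chartAt (EuclideanSpace ℝ (Fin n)) y).symm)
        (chartAt (EuclideanSpace ℝ (Fin n)) y y)) (chartAt (EuclideanSpace ℝ (Fin n)) y y) :=
  (((hc y).contDiffAt ((chartAt (EuclideanSpace ℝ (Fin n)) y).open_target.mem_nhds
    (mem_chart_target _ y))).differentiableAt (by simp)).hasFDerivAt

theorem SmoothInCharts.spaceDeriv_sub {c d : N → E} (hc : SmoothInCharts n c)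
    (hd : SmoothInCharts n d) (y : N) (v : TangentSpace (𝓡 n) y) :
    spaceDeriv n (fun y => c y - d y) y v = spaceDeriv n c y v - spaceDeriv n d y v := by
  have h : fderiv ℝ ((fun y => c y - d y) ∘ (chartAt (EuclideanSpace ℝ (Fin n)) y).symm)
      (chartAt (EuclideanSpace ℝ (Fin n)) y y) = _ :=
    ((hc.hasFDerivAt y).sub (hd.hasFDerivAt y)).fderiv
  rw [spaceDeriv_apply, h]
  rfl

theorem spaceDeriv_sum {ι : Type*} (s : Finset ι) {c : ι → N → E}
    (hc : ∀ i, SmoothInCharts n (c i)) (y : N) (v : TangentSpace (𝓡 n) y) :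
    spaceDeriv n (fun y => ∑ i ∈ s, c i y) y v = ∑ i ∈ s, spaceDeriv n (c i) y v := by
  have h : fderiv ℝ ((fun y => ∑ i ∈ s, c i y) ∘ (chartAt (EuclideanSpace ℝ (Fin n)) y).symm)
      (chartAt (EuclideanSpace ℝ (Fin n)) y y) = _ :=
    (HasFDerivAt.fun_sum fun i (_ : i ∈ s) => (hc i).hasFDerivAt y).fderiv
  rw [spaceDeriv_apply, h, sum_apply]
  rfl

theorem SmoothInCharts.sum {ι : Type*} (s : Finset ι) {c : ι → N → E}
    (hc : ∀ i, SmoothInCharts n (c i)) : SmoothInCharts n (fun y => ∑ i ∈ s, c i y) :=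
  fun p => ContDiffOn.sum fun i _ => hc i p

theorem SmoothFamily.hasDerivAt_spaceDeriv {δ : ℝ} {F : ℝ → N → E} (hF : SmoothFamily n δ F)
    {t : ℝ} (ht : t ∈ Ioo (-δ) δ) (y : N) (v : TangentSpace (𝓡 n) y) :
    HasDerivAt (fun s => spaceDeriv n (F s) y v) (spaceDeriv n (timeDeriv F t) y v) t :=
  hF.hasDerivAt_fderiv y ht (mem_chart_target _ y) _

theorem euclideanDeriv_eq_spaceDeriv [IsManifold (𝓡 n) ∞ N] {c : N → EuclideanSpace ℝ (Fin q)}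
    {y : N} (hc : MDifferentiableAt (𝓡 n) (𝓡 q) c y) (v : TangentSpace (𝓡 n) y) :
    euclideanDeriv c y v = spaceDeriv n c y v :=
  euclideanDeriv_eq_fderiv (mem_chart_source _ y) hc v

end SpaceDerivative

section SecondFundamentalForm

variable {n q : ℕ} {N : Type*} [TopologicalSpace N] [ChartedSpace (EuclideanSpace ℝ (Fin n)) N]

theorem tangentProj_idem (f : N → EuclideanSpace ℝ (Fin q)) (y : N)
    (a : EuclideanSpace ℝ (Fin q)) :
    tangentProj (n := n) f y (tangentProj (n := n) f y a) = tangentProj (n := n) f y a :=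
  Submodule.starProjection_eq_self_iff.2 (Submodule.starProjection_apply_mem _ _)

theorem inner_tangentProj_left (f : N → EuclideanSpace ℝ (Fin q)) (y : N)
    (a b : EuclideanSpace ℝ (Fin q)) :
    inner ℝ (tangentProj (n := n) f y a) b = inner ℝ a (tangentProj (n := n) f y b) :=
  Submodule.inner_starProjection_left_eq_right _ a b

theorem tangentProj_euclideanDeriv (f : N → EuclideanSpace ℝ (Fin q)) (y : N)
    (v : TangentSpace (𝓡 n) y) :
    tangentProj (n := n) f y (euclideanDeriv f y v) = euclideanDeriv f y v :=
  Submodule.starProjection_eq_self_iff.2 ⟨v, rfl⟩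

theorem secondFundamentalForm_eq (f : N → EuclideanSpace ℝ (Fin q)) (y : N)
    (v w : TangentSpace (𝓡 n) y) :
    secondFundamentalForm f y v w =
      fderiv ℝ (fderiv ℝ (f ∘ (chartAt (EuclideanSpace ℝ (Fin n)) y).symm))
        (chartAt (EuclideanSpace ℝ (Fin n)) y y)
        (chartDifferential n y v) (chartDifferential n y w) -
      tangentProj (n := n) f y
        (fderiv ℝ (fderiv ℝ (f ∘ (chartAt (EuclideanSpace ℝ (Fin n)) y).symm))
        (chartAt (EuclideanSpace ℝ (Fin n)) y y)
        (chartDifferential n y v) (chartDifferential n y w)) := by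
  rw [secondFundamentalForm, Submodule.starProjection_orthogonal_val]
  rfl

theorem tangentProj_secondFundamentalForm (f : N → EuclideanSpace ℝ (Fin q)) (y : N)
    (v w : TangentSpace (𝓡 n) y) :
    tangentProj (n := n) f y (secondFundamentalForm f y v w) = 0 := by
  rw [secondFundamentalForm_eq, map_sub, tangentProj_idem, sub_self]

/-- The second fundamental form as a bilinear map. -/
noncomputable def secondFundamentalFormₗ (f : N → EuclideanSpace ℝ (Fin q)) (y : N) :
    TangentSpace (𝓡 n) y →ₗ[ℝ] TangentSpace (𝓡 n) y →ₗ[ℝ] EuclideanSpace ℝ (Fin q) :=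
  LinearMap.mk₂ ℝ (secondFundamentalForm f y)
    (fun v v' w => by simp only [secondFundamentalForm_eq, map_add, add_apply]; abel)
    (fun c v w => by simp only [secondFundamentalForm_eq, map_smul, smul_apply, smul_sub])
    (fun v w w' => by simp only [secondFundamentalForm_eq, map_add]; abel)
    (fun c v w => by simp only [secondFundamentalForm_eq, map_smul, smul_sub])

theorem secondFundamentalFormₗ_apply (f : N → EuclideanSpace ℝ (Fin q)) (y : N)
    (v w : TangentSpace (𝓡 n) y) :
    secondFundamentalFormₗ f y v w = secondFundamentalForm f y v w := rfl

variable [RiemannianBundle (fun y : N => TangentSpace (𝓡 n) y)] [IsManifold (𝓡 n) ∞ N]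
  {f : N → EuclideanSpace ℝ (Fin q)}

namespace IsIsometricImmersion

theorem contDiffAt_chart (hf : IsIsometricImmersion n f) (y : N) :
    ContDiffAt ℝ ∞ (f ∘ (chartAt (EuclideanSpace ℝ (Fin n)) y).symm)
      (chartAt (EuclideanSpace ℝ (Fin n)) y y) :=
  (hf.1.smoothInCharts y).contDiffAt ((chartAt (EuclideanSpace ℝ (Fin n)) y).open_target.mem_nhds
    (mem_chart_target _ y))

theorem hasFDerivAt_fderiv (hf : IsIsometricImmersion n f) (y : N) :
    HasFDerivAt (fderiv ℝ (f ∘ (chartAt (EuclideanSpace ℝ (Fin n)) y).symm))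
      (fderiv ℝ (fderiv ℝ (f ∘ (chartAt (EuclideanSpace ℝ (Fin n)) y).symm))
        (chartAt (EuclideanSpace ℝ (Fin n)) y y)) (chartAt (EuclideanSpace ℝ (Fin n)) y y) :=
  (((hf.contDiffAt_chart y).fderiv_right (m := 1) (by norm_cast)).differentiableAt
    (by simp)).hasFDerivAt

theorem tangentProj_fderiv_chart (hf : IsIsometricImmersion n f) (p : N)
    {z : EuclideanSpace ℝ (Fin n)} (hz : z ∈ (chartAt (EuclideanSpace ℝ (Fin n)) p).target)
    (ξ : EuclideanSpace ℝ (Fin n)) :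
    tangentProj (n := n) f ((chartAt (EuclideanSpace ℝ (Fin n)) p).symm z)
      (fderiv ℝ (f ∘ (chartAt (EuclideanSpace ℝ (Fin n)) p).symm) z ξ) =
      fderiv ℝ (f ∘ (chartAt (EuclideanSpace ℝ (Fin n)) p).symm) z ξ := by
  rw [← euclideanDeriv_mfderiv_chart_symm p hz (hf.mdifferentiableAt _),
    tangentProj_euclideanDeriv]

theorem secondFundamentalForm_comm (hf : IsIsometricImmersion n f) (y : N)
    (v w : TangentSpace (𝓡 n) y) :
    secondFundamentalForm f y v w = secondFundamentalForm f y w v := by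
  have h := (hf.contDiffAt_chart y).isSymmSndFDerivAt (by simp; norm_cast)
  rw [secondFundamentalForm_eq, secondFundamentalForm_eq, h.eq]

theorem spaceDeriv_eq (hf : IsIsometricImmersion n f) (y : N) (v : TangentSpace (𝓡 n) y) :
    spaceDeriv n f y v = euclideanDeriv f y v :=
  (euclideanDeriv_eq_spaceDeriv (hf.mdifferentiableAt y) v).symm

theorem spaceDeriv_tangentProj_apply (hf : IsIsometricImmersion n f) (y : N)
    (v : TangentSpace (𝓡 n) y) (a : EuclideanSpace ℝ (Fin q)) :
    spaceDeriv n (fun y => tangentProj (n := n) f y a) y v =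
      spaceDeriv n (tangentProj (n := n) f) y v a := by
  have h : fderiv ℝ ((fun y => tangentProj (n := n) f y a) ∘
      (chartAt (EuclideanSpace ℝ (Fin n)) y).symm) (chartAt (EuclideanSpace ℝ (Fin n)) y y) = _ :=
    ((hf.smoothInCharts_tangentProj.hasFDerivAt y).clm_apply (hasFDerivAt_const a _)).fderiv
  rw [spaceDeriv_apply, h]
  simp [spaceDeriv_apply]

/-- The derivative of a family of self-adjoint maps is self-adjoint. -/
theorem inner_spaceDeriv_tangentProj (hf : IsIsometricImmersion n f) (y : N)
    (v : TangentSpace (𝓡 n) y) (a b : EuclideanSpace ℝ (Fin q)) :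
    inner ℝ (spaceDeriv n (tangentProj (n := n) f) y v a) b =
      inner ℝ a (spaceDeriv n (tangentProj (n := n) f) y v b) := by
  set φ := chartAt (EuclideanSpace ℝ (Fin n)) y with hφ
  set z := φ y
  have h0 := fun a : EuclideanSpace ℝ (Fin q) =>
    (hf.smoothInCharts_tangentProj.hasFDerivAt y).clm_apply (hasFDerivAt_const a z)
  have h1 := ((h0 a).inner ℝ (hasFDerivAt_const b z)).fderiv
  have h2 := ((hasFDerivAt_const a z).inner ℝ (h0 b)).fderiv
  simp only [Function.comp, inner_tangentProj_left] at h1 h2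
  have h4 := congrArg (fun L => L (chartDifferential n y v)) (h1.symm.trans h2)
  simpa [spaceDeriv_apply] using h4

/-- The derivative of the identity `P² = P`. -/
theorem spaceDeriv_tangentProj_eq (hf : IsIsometricImmersion n f) (y : N)
    (v : TangentSpace (𝓡 n) y) (a : EuclideanSpace ℝ (Fin q)) :
    spaceDeriv n (tangentProj (n := n) f) y v a =
      spaceDeriv n (tangentProj (n := n) f) y v (tangentProj (n := n) f y a) +
        tangentProj (n := n) f y (spaceDeriv n (tangentProj (n := n) f) y v a) := by
  set φ := chartAt (EuclideanSpace ℝ (Fin n)) y with hφ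
  have hy : φ.symm (φ y) = y := φ.left_inv (mem_chart_source _ y)
  have h0 := hf.smoothInCharts_tangentProj.hasFDerivAt y
  have h1 := h0.clm_apply (hasFDerivAt_const a (φ y))
  have h2 := (h0.clm_apply h1).fderiv
  simp only [Function.comp, tangentProj_idem] at h2
  have h4 := congrArg (fun L => L (chartDifferential n y v)) (h1.fderiv.symm.trans h2)
  simp only [← hφ, hy] at h4
  simpa [spaceDeriv_apply, add_comm] using h4

/-- The derivative of the tangential projection, applied to tangent vectors, is the second
fundamental form. -/
theorem spaceDeriv_tangentProj_euclideanDeriv (hf : IsIsometricImmersion n f) (y : N)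
    (v w : TangentSpace (𝓡 n) y) :
    spaceDeriv n (tangentProj (n := n) f) y v (euclideanDeriv f y w) =
      secondFundamentalForm f y v w := by
  set φ := chartAt (EuclideanSpace ℝ (Fin n)) y with hφ
  have hy : φ.symm (φ y) = y := φ.left_inv (mem_chart_source _ y)
  have h0 := hf.smoothInCharts_tangentProj.hasFDerivAt y
  have h1 := (hf.hasFDerivAt_fderiv y).clm_apply (hasFDerivAt_const (chartDifferential n y w) (φ y))
  have h2 := (h0.clm_apply h1).fderiv
  have h3 : (fun z => tangentProj (n := n) f (φ.symm z)
      (fderiv ℝ (f ∘ φ.symm) z (chartDifferential n y w))) =ᶠ[nhds (φ y)]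
      fun z => fderiv ℝ (f ∘ φ.symm) z (chartDifferential n y w) := by
    filter_upwards [φ.open_target.mem_nhds (mem_chart_target _ y)] with z hz
    exact hf.tangentProj_fderiv_chart y hz _
  have h4 := (h3.fderiv_eq.symm.trans h2).symm.trans h1.fderiv
  have h5 := congrArg (fun L => L (chartDifferential n y v)) h4
  simp only [Function.comp, ← hφ, hy] at h5
  rw [secondFundamentalForm_eq, ← hφ, ← hf.spaceDeriv_eq, spaceDeriv_apply, spaceDeriv_apply,
    ← hφ, eq_sub_iff_add_eq]
  simpa [add_comm] using h5

/-- Differentiating the orthogonality of a normal field to the tangent vectors. -/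
theorem inner_spaceDeriv_normal (hf : IsIsometricImmersion n f)
    {c : N → EuclideanSpace ℝ (Fin q)} (hc : SmoothInCharts n c) (y : N)
    (v w : TangentSpace (𝓡 n) y) :
    inner ℝ (spaceDeriv n (fun y => c y - tangentProj (n := n) f y (c y)) y v)
      (euclideanDeriv f y w) = - inner ℝ (c y) (secondFundamentalForm f y v w) := by
  set φ := chartAt (EuclideanSpace ℝ (Fin n)) y with hφ
  have hy : φ.symm (φ y) = y := φ.left_inv (mem_chart_source _ y)
  set ν : N → EuclideanSpace ℝ (Fin q) := fun y => c y - tangentProj (n := n) f y (c y) with hνdef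
  have hν : SmoothInCharts n ν := fun p =>
    (hc p).sub ((hf.smoothInCharts_tangentProj p).clm_apply (hc p))
  have h1 := (hf.hasFDerivAt_fderiv y).clm_apply (hasFDerivAt_const (chartDifferential n y w) (φ y))
  have h2 := ((hν.hasFDerivAt y).inner ℝ h1).fderiv
  have h3 : (fun z => inner ℝ ((ν ∘ φ.symm) z)
      (fderiv ℝ (f ∘ φ.symm) z (chartDifferential n y w))) =ᶠ[nhds (φ y)] fun _ => (0 : ℝ) := by
    filter_upwards [φ.open_target.mem_nhds (mem_chart_target _ y)] with z hz
    rw [Function.comp, hνdef, inner_sub_left, inner_tangentProj_left,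
      hf.tangentProj_fderiv_chart y hz, sub_self]
  have h4 := h2.symm.trans (h3.fderiv_eq.trans (fderiv_const_apply _))
  have h5 := congrArg (fun L => L (chartDifferential n y v)) h4
  rw [secondFundamentalForm_eq, ← hφ, ← hf.spaceDeriv_eq, spaceDeriv_apply, spaceDeriv_apply,
    ← hφ, inner_sub_right, ← inner_tangentProj_left, ← inner_sub_left, eq_neg_iff_add_eq_zero]
  have hνy : ν (φ.symm (φ y)) = c y - tangentProj (n := n) f y (c y) := by rw [hy]
  rw [← hνy]
  have h6 : inner ℝ (ν (φ.symm (φ y))) (fderiv ℝ (fderiv ℝ (f ∘ φ.symm)) (φ y)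
      (chartDifferential n y v) (chartDifferential n y w)) +
      inner ℝ (fderiv ℝ (ν ∘ φ.symm) (φ y) (chartDifferential n y v))
        (fderiv ℝ (f ∘ φ.symm) (φ y) (chartDifferential n y w)) = (0 : ℝ) := by
    simp only [ContinuousLinearMap.comp_apply, ContinuousLinearMap.prod_apply,
      fderivInnerCLM_apply, ContinuousLinearMap.comp_zero, zero_add, zero_apply,
      ContinuousLinearMap.flip_apply] at h5
    exact h5
  rw [← h6, add_comm]

/-- The normal component of the acceleration of a deformation with velocity `v` at `y` is
`B(v, v)`. -/
theorem normal_acceleration (hf : IsIsometricImmersion n f) {Z : N → EuclideanSpace ℝ (Fin q)}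
    {δ : ℝ} {Ψ : ℝ → N → N} (h : IsDeformation n f Z δ Ψ) (y : N) (v : TangentSpace (𝓡 n) y)
    (hv : euclideanDeriv f y v = Z y) :
    timeDeriv (timeDeriv fun t y => f (Ψ t y)) 0 y -
      tangentProj (n := n) f y (timeDeriv (timeDeriv fun t y => f (Ψ t y)) 0 y) =
      secondFundamentalForm f y v v := by
  set φ := chartAt (EuclideanSpace ℝ (Fin n)) y with hφ
  set γ : ℝ → EuclideanSpace ℝ (Fin n) := fun t => φ (Ψ t y) with hγ
  have hγs : ContDiffAt ℝ ∞ γ 0 := h.contDiffAt_chart y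
  have hγ0 : γ 0 = φ y := by rw [hγ]; simp only [h.zero]
  have hξ : deriv γ 0 = chartDifferential n y v := by
    apply hf.injective_chart y (mem_chart_target _ y)
    rw [h.velocity_chart hf.1 y, ← hv, ← hf.spaceDeriv_eq]
    rfl
  have htgt : ∀ᶠ t in nhds (0 : ℝ), γ t ∈ φ.target := by
    filter_upwards [h.eventually_mem_source y] with t ht using φ.map_source ht
  have hγd : ∀ᶠ t in nhds (0 : ℝ), HasDerivAt γ (deriv γ t) t := by
    have h1 := (hγs.of_le (m := 1) (by norm_cast)).eventually (by simp)
    filter_upwards [h1] with t ht using (ht.differentiableAt (by simp)).hasDerivAt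
  have hγ2 : HasDerivAt (deriv γ) (deriv (deriv γ) 0) 0 := by
    have h1 : ContDiffAt ℝ 1 (fun t => fderiv ℝ γ t 1) 0 :=
      (hγs.fderiv_right (m := 1) (by norm_cast)).clm_apply contDiffAt_const
    simp only [fderiv_apply_one_eq_deriv] at h1
    exact (h1.differentiableAt (by simp)).hasDerivAt
  have hH : (fun t => f (Ψ t y)) =ᶠ[nhds 0] fun t => (f ∘ φ.symm) (γ t) := by
    filter_upwards [h.eventually_mem_source y] with t ht
    simp only [Function.comp, hγ]
    rw [φ.left_inv ht]
  have hH1 : (fun t => timeDeriv (fun t y => f (Ψ t y)) t y) =ᶠ[nhds 0]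
      fun t => fderiv ℝ (f ∘ φ.symm) (γ t) (deriv γ t) := by
    filter_upwards [hH.eventuallyEq_nhds, htgt, hγd] with t ht1 ht2 ht3
    have hd : DifferentiableAt ℝ (f ∘ φ.symm) (γ t) :=
      ((hf.1.smoothInCharts y).contDiffAt (φ.open_target.mem_nhds ht2)).differentiableAt (by simp)
    have h1 := hd.hasFDerivAt.comp_hasDerivAt t ht3
    exact (h1.congr_of_eventuallyEq ht1).deriv
  have h2 : HasDerivAt (fun t => fderiv ℝ (f ∘ φ.symm) (γ t) (deriv γ t))
      (fderiv ℝ (fderiv ℝ (f ∘ φ.symm)) (φ y) (deriv γ 0) (deriv γ 0) +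
        fderiv ℝ (f ∘ φ.symm) (φ y) (deriv (deriv γ) 0)) 0 := by
    have h3 := HasFDerivAt.comp_hasDerivAt (x := (0 : ℝ)) (f := γ)
      (l := fderiv ℝ (f ∘ φ.symm)) (by rw [hγ0]; exact hf.hasFDerivAt_fderiv y) hγd.self_of_nhds
    have h4 := h3.clm_apply hγ2
    simp only [Function.comp, hγ0] at h4
    exact h4
  have h5 : timeDeriv (timeDeriv fun t y => f (Ψ t y)) 0 y = _ :=
    (h2.congr_of_eventuallyEq hH1).deriv
  have h6 : tangentProj (n := n) f y (fderiv ℝ (f ∘ φ.symm) (φ y) (deriv (deriv γ) 0)) =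
      fderiv ℝ (f ∘ φ.symm) (φ y) (deriv (deriv γ) 0) := by
    have h7 := hf.tangentProj_fderiv_chart y (mem_chart_target _ y) (deriv (deriv γ) 0)
    rwa [φ.left_inv (mem_chart_source _ y)] at h7
  rw [h5, secondFundamentalForm_eq, map_add, h6, hξ]
  abel

end IsIsometricImmersion

end SecondFundamentalForm

/-! ### The first and second variation of the energy density -/

section CubicTrace

variable {κ : Type*} [Fintype κ]

theorem hasDerivAt_cubic_trace (μ : κ → ℝ) {G G' : κ → κ → ℝ → ℝ} {t : ℝ}
    (h : ∀ l k, HasDerivAt (G l k) (G' l k t) t) :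
    HasDerivAt (fun s => (∑ l, ∑ k, ∑ r, μ l * μ k * μ r * (G l k s * G k r s * G r l s)) / 6)
      ((∑ l, ∑ k, ∑ r, μ l * μ k * μ r * ((G' l k t * G k r t + G l k t * G' k r t) * G r l t +
        G l k t * G k r t * G' r l t)) / 6) t := by
  refine HasDerivAt.div_const ?_ 6
  refine HasDerivAt.fun_sum fun l _ => HasDerivAt.fun_sum fun k _ =>
    HasDerivAt.fun_sum fun r _ => ?_
  exact ((((h l k).mul (h k r)).mul (h r l)).const_mul _)

/-- The first derivative of `tr (D G)³ / 6`, where `D` is the diagonal matrix with entries `μ`, at a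
time where the symmetric matrix `G` is the identity. -/
theorem deriv_cubic_trace [DecidableEq κ] (μ : κ → ℝ) {G G' : κ → κ → ℝ → ℝ} {t : ℝ}
    (h : ∀ l k, HasDerivAt (G l k) (G' l k t) t)
    (h0 : ∀ l k, G l k t = if l = k then 1 else 0) :
    deriv (fun s => (∑ l, ∑ k, ∑ r, μ l * μ k * μ r * (G l k s * G k r s * G r l s)) / 6) t =
      (∑ l, μ l ^ 3 * G' l l t) / 2 := by
  rw [(hasDerivAt_cubic_trace μ h).deriv]
  simp only [h0, mul_ite, ite_mul, mul_one, one_mul, mul_zero, zero_mul, mul_add,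
    Finset.sum_add_distrib, Finset.sum_ite_eq, Finset.sum_ite_eq', Finset.mem_univ, if_true]
  have h3 : ∑ l, μ l ^ 3 * G' l l t = ∑ l, μ l * μ l * μ l * G' l l t :=
    Finset.sum_congr rfl fun l _ => by ring
  rw [h3]
  ring

/-- The second derivative of `tr (D G)³ / 6` at a time where `G` is the identity. -/
theorem deriv_deriv_cubic_trace [DecidableEq κ] (μ : κ → ℝ) {G G' : κ → κ → ℝ → ℝ}
    {G'' : κ → κ → ℝ} {t : ℝ} (h : ∀ᶠ s in nhds t, ∀ l k, HasDerivAt (G l k) (G' l k s) s)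
    (h' : ∀ l k, HasDerivAt (G' l k) (G'' l k) t)
    (h0 : ∀ l k, G l k t = if l = k then 1 else 0) (hsymm : ∀ l k, G' l k t = G' k l t) :
    deriv (deriv fun s =>
      (∑ l, ∑ k, ∑ r, μ l * μ k * μ r * (G l k s * G k r s * G r l s)) / 6) t =
      (∑ l, μ l ^ 3 * G'' l l) / 2 + ∑ l, ∑ k, μ l ^ 2 * μ k * G' l k t ^ 2 := by
  have h1 : (deriv fun s =>
      (∑ l, ∑ k, ∑ r, μ l * μ k * μ r * (G l k s * G k r s * G r l s)) / 6) =ᶠ[nhds t] fun t =>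
      (∑ l, ∑ k, ∑ r, μ l * μ k * μ r * ((G' l k t * G k r t + G l k t * G' k r t) * G r l t +
        G l k t * G k r t * G' r l t)) / 6 := by
    filter_upwards [h] with s hs using (hasDerivAt_cubic_trace μ hs).deriv
  have hG := h.self_of_nhds
  have h2 : HasDerivAt (fun t =>
      (∑ l, ∑ k, ∑ r, μ l * μ k * μ r * ((G' l k t * G k r t + G l k t * G' k r t) * G r l t +
        G l k t * G k r t * G' r l t)) / 6)
      ((∑ l, ∑ k, ∑ r, μ l * μ k * μ r *
        ((G'' l k * G k r t + G' l k t * G' k r t + (G' l k t * G' k r t + G l k t * G'' k r)) *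
          G r l t + (G' l k t * G k r t + G l k t * G' k r t) * G' r l t +
          ((G' l k t * G k r t + G l k t * G' k r t) * G' r l t +
            G l k t * G k r t * G'' r l))) / 6) t := by
    refine HasDerivAt.div_const ?_ 6
    refine HasDerivAt.fun_sum fun l _ => HasDerivAt.fun_sum fun k _ =>
      HasDerivAt.fun_sum fun r _ => ?_
    exact ((((((h' l k).mul (hG k r)).add ((hG l k).mul (h' k r))).mul (hG r l)).add
      (((hG l k).mul (hG k r)).mul (h' r l))).const_mul _)
  rw [h1.deriv_eq, h2.deriv]
  have e1 : ∑ l, μ l ^ 3 * G'' l l = ∑ l, μ l * μ l * μ l * G'' l l :=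
    Finset.sum_congr rfl fun l _ => by ring
  have e2 : ∑ l, ∑ k, μ l ^ 2 * μ k * G' l k t ^ 2 =
      ∑ l, ∑ k, μ l * μ l * μ k * (G' l k t * G' k l t) :=
    Finset.sum_congr rfl fun l _ => Finset.sum_congr rfl fun k _ => by rw [hsymm k l]; ring
  simp only [h0, mul_ite, ite_mul, mul_one, one_mul, mul_zero, zero_mul, mul_add, add_mul,
    Finset.sum_add_distrib, Finset.sum_ite_eq, Finset.sum_ite_eq', Finset.mem_univ, if_true]
  have e3 : (∑ l, ∑ k, ∑ r, if l = k then μ l * μ k * μ r * (G' k r t * G' r l t) else 0) =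
      ∑ l, ∑ k, μ l * μ l * μ k * (G' l k t * G' k l t) := by
    refine Finset.sum_congr rfl fun l _ => ?_
    rw [Finset.sum_comm]
    simp only [Finset.sum_ite_eq, Finset.mem_univ, if_true]
  have e4 : ∑ l, ∑ k, μ l * μ k * μ l * (G' l k t * G' k l t) =
      ∑ l, ∑ k, μ l * μ l * μ k * (G' l k t * G' k l t) :=
    Finset.sum_congr rfl fun l _ => Finset.sum_congr rfl fun k _ => by ring
  have e5 : ∑ l, ∑ k, μ l * μ k * μ k * (G' l k t * G' k l t) =
      ∑ l, ∑ k, μ l * μ l * μ k * (G' l k t * G' k l t) := by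
    rw [Finset.sum_comm]
    exact Finset.sum_congr rfl fun l _ => Finset.sum_congr rfl fun k _ => by ring
  rw [e1, e2, e3, e4, e5]
  ring

end CubicTrace

section DeformationEnergy

variable {m n q : ℕ} {M N : Type*}
  [TopologicalSpace M] [ChartedSpace (EuclideanSpace ℝ (Fin m)) M]
  [TopologicalSpace N] [ChartedSpace (EuclideanSpace ℝ (Fin n)) N]
  {f Z : N → EuclideanSpace ℝ (Fin q)} {δ : ℝ} {Ψ : ℝ → N → N} {u : M → N}

theorem IsDeformation.timeDeriv_zero (h : IsDeformation n f Z δ Ψ) :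
    timeDeriv (fun t y => f (Ψ t y)) 0 = Z := funext fun y => (h.velocity y).deriv

variable [RiemannianBundle (fun y : N => TangentSpace (𝓡 n) y)]

theorem IsIsometricImmersion.inner_euclideanDeriv_basis (hf : IsIsometricImmersion n f) {y : N}
    (e : OrthonormalBasis (Fin n) ℝ (TangentSpace (𝓡 n) y)) (l k : Fin n) :
    inner ℝ (euclideanDeriv f y (e l)) (euclideanDeriv f y (e k)) =
      if l = k then (1 : ℝ) else 0 := by
  rw [hf.2, orthonormal_iff_ite.1 e.orthonormal]

variable [RiemannianBundle (fun x : M => TangentSpace (𝓡 m) x)] [IsManifold (𝓡 n) ∞ N]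

/-- The energy density of `Ψ t ∘ u` in terms of principal stretches `μ` and principal directions
`e` of `u` at `x`, which do not depend on `t`. -/
theorem IsDeformation.phiThreeDensity_eq_sum (h : IsDeformation n f Z δ Ψ)
    (hf : IsIsometricImmersion n f) (hu : ContMDiff (𝓡 m) (𝓡 n) ∞ u) {t : ℝ}
    (ht : t ∈ Ioo (-δ) δ) (x : M)
    (e : OrthonormalBasis (Fin n) ℝ (TangentSpace (𝓡 n) (u x))) (μ : Fin n → ℝ)
    (hμ : ∀ l k, ∑ i, inner ℝ (mfderiv (𝓡 m) (𝓡 n) u x (tangentFrame x i)) (e l) *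
      inner ℝ (mfderiv (𝓡 m) (𝓡 n) u x (tangentFrame x i)) (e k) = if l = k then μ l else 0) :
    phiThreeDensity m n (fun x => Ψ t (u x)) x =
      (∑ l, ∑ k, ∑ r, μ l * μ k * μ r *
        (inner ℝ (spaceDeriv n (fun y => f (Ψ t y)) (u x) (e l))
            (spaceDeriv n (fun y => f (Ψ t y)) (u x) (e k)) *
          inner ℝ (spaceDeriv n (fun y => f (Ψ t y)) (u x) (e k))
            (spaceDeriv n (fun y => f (Ψ t y)) (u x) (e r)) *
          inner ℝ (spaceDeriv n (fun y => f (Ψ t y)) (u x) (e r))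
            (spaceDeriv n (fun y => f (Ψ t y)) (u x) (e l)))) / 6 := by
  have hΨ : ∀ y, MDifferentiableAt (𝓡 n) (𝓡 n) (Ψ t) y := fun y => by
    have h1 := h.smooth.contMDiffAt (x := (t, y))
      ((isOpen_Ioo.prod isOpen_univ).mem_nhds ⟨ht, mem_univ _⟩)
    exact (h1.comp y (contMDiffAt_const.prodMk contMDiffAt_id)).mdifferentiableAt (by simp)
  have hux : MDifferentiableAt (𝓡 m) (𝓡 n) u x := hu.mdifferentiableAt (by simp)
  have hH : MDifferentiableAt (𝓡 n) (𝓡 q) (fun y => f (Ψ t y)) (u x) :=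
    (hf.mdifferentiableAt _).comp (u x) (hΨ (u x))
  have hK : ∀ i, euclideanDeriv f (Ψ t (u x))
      (mfderiv (𝓡 m) (𝓡 n) (fun x => Ψ t (u x)) x (tangentFrame x i)) =
      (spaceDeriv n (fun y => f (Ψ t y)) (u x)).toLinearMap
        (mfderiv (𝓡 m) (𝓡 n) u x (tangentFrame x i)) := by
    intro i
    rw [← euclideanDeriv_comp (u := fun x => Ψ t (u x)) (hf.mdifferentiableAt _)
      ((hΨ (u x)).comp x hux), ContinuousLinearMap.coe_coe, ← euclideanDeriv_eq_spaceDeriv hH]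
    exact euclideanDeriv_comp hH hux _
  rw [hf.phiThreeDensity_eq_trace_euclidean]
  simp only [hK]
  rw [trace_gram_cube_eq_sum e _ _ μ hμ]
  rfl

/-- First variation of the energy density. -/
theorem IsDeformation.timeDeriv_phiThreeDensity
    (h : IsDeformation n f Z δ Ψ) (hf : IsIsometricImmersion n f)
    (hu : ContMDiff (𝓡 m) (𝓡 n) ∞ u) (x : M)
    (e : OrthonormalBasis (Fin n) ℝ (TangentSpace (𝓡 n) (u x))) (μ : Fin n → ℝ)
    (hμ : ∀ l k, ∑ i, inner ℝ (mfderiv (𝓡 m) (𝓡 n) u x (tangentFrame x i)) (e l) *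
      inner ℝ (mfderiv (𝓡 m) (𝓡 n) u x (tangentFrame x i)) (e k) = if l = k then μ l else 0) :
    timeDeriv (fun t => phiThreeDensity m n (fun x => Ψ t (u x))) 0 x =
      ∑ l, μ l ^ 3 * inner ℝ (spaceDeriv n Z (u x) (e l)) (euclideanDeriv f (u x) (e l)) := by
  have hH := h.smoothFamily hf.1
  have hev : (fun t => phiThreeDensity m n (fun x => Ψ t (u x)) x) =ᶠ[nhds 0] _ :=
    Filter.eventuallyEq_of_mem (isOpen_Ioo.mem_nhds h.zero_mem) fun t ht =>
      h.phiThreeDensity_eq_sum hf hu ht x e μ hμ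
  have hb : (fun y => f (Ψ 0 y)) = f := funext fun y => by rw [h.zero]
  have hd := fun l => hH.hasDerivAt_spaceDeriv h.zero_mem (u x) (e l)
  rw [h.timeDeriv_zero] at hd
  change deriv _ 0 = _
  rw [hev.deriv_eq]
  rw [deriv_cubic_trace μ (G := fun l k t => inner ℝ (spaceDeriv n (fun y => f (Ψ t y)) (u x) (e l))
            (spaceDeriv n (fun y => f (Ψ t y)) (u x) (e k)))
      (G' := fun l k _ => inner ℝ (spaceDeriv n (fun y => f (Ψ 0 y)) (u x) (e l))
            (spaceDeriv n Z (u x) (e k)) + inner ℝ (spaceDeriv n Z (u x) (e l))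
            (spaceDeriv n (fun y => f (Ψ 0 y)) (u x) (e k)))
      (fun l k => (hd l).inner ℝ (hd k)) (fun l k => by
        simp only [hb, hf.spaceDeriv_eq, hf.inner_euclideanDeriv_basis])]
  rw [Finset.sum_div]
  refine Finset.sum_congr rfl fun l _ => ?_
  simp only [hb, hf.spaceDeriv_eq]
  rw [real_inner_comm (spaceDeriv n Z (u x) (e l))]
  ring

/-- Second variation of the energy density. -/
theorem IsDeformation.timeDeriv_timeDeriv_phiThreeDensity
    (h : IsDeformation n f Z δ Ψ) (hf : IsIsometricImmersion n f)
    (hu : ContMDiff (𝓡 m) (𝓡 n) ∞ u) (x : M)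
    (e : OrthonormalBasis (Fin n) ℝ (TangentSpace (𝓡 n) (u x))) (μ : Fin n → ℝ)
    (hμ : ∀ l k, ∑ i, inner ℝ (mfderiv (𝓡 m) (𝓡 n) u x (tangentFrame x i)) (e l) *
      inner ℝ (mfderiv (𝓡 m) (𝓡 n) u x (tangentFrame x i)) (e k) = if l = k then μ l else 0) :
    timeDeriv (timeDeriv fun t => phiThreeDensity m n (fun x => Ψ t (u x))) 0 x =
      ∑ l, μ l ^ 3 * (inner ℝ (spaceDeriv n Z (u x) (e l)) (spaceDeriv n Z (u x) (e l)) +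
        inner ℝ (spaceDeriv n (timeDeriv (timeDeriv fun t y => f (Ψ t y)) 0) (u x) (e l))
          (euclideanDeriv f (u x) (e l))) +
      ∑ l, ∑ k, μ l ^ 2 * μ k * (inner ℝ (spaceDeriv n Z (u x) (e l))
          (euclideanDeriv f (u x) (e k)) +
        inner ℝ (spaceDeriv n Z (u x) (e k)) (euclideanDeriv f (u x) (e l))) ^ 2 := by
  have hH := h.smoothFamily hf.1
  have hev : (fun t => phiThreeDensity m n (fun x => Ψ t (u x)) x) =ᶠ[nhds 0] _ :=
    Filter.eventuallyEq_of_mem (isOpen_Ioo.mem_nhds h.zero_mem) fun t ht =>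
      h.phiThreeDensity_eq_sum hf hu ht x e μ hμ
  have hb : (fun y => f (Ψ 0 y)) = f := funext fun y => by rw [h.zero]
  have hd := fun (t : ℝ) (ht : t ∈ Ioo (-δ) δ) l => hH.hasDerivAt_spaceDeriv ht (u x) (e l)
  have hd' := fun l =>
    hH.smoothFamily_timeDeriv.hasDerivAt_spaceDeriv h.zero_mem (u x) (e l)
  change deriv (deriv _) 0 = _
  rw [hev.deriv.deriv_eq]
  rw [deriv_deriv_cubic_trace μ
      (G := fun l k t => inner ℝ (spaceDeriv n (fun y => f (Ψ t y)) (u x) (e l))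
            (spaceDeriv n (fun y => f (Ψ t y)) (u x) (e k)))
      (G' := fun l k t => inner ℝ (spaceDeriv n (fun y => f (Ψ t y)) (u x) (e l))
            (spaceDeriv n (timeDeriv (fun t y => f (Ψ t y)) t) (u x) (e k)) +
          inner ℝ (spaceDeriv n (timeDeriv (fun t y => f (Ψ t y)) t) (u x) (e l))
            (spaceDeriv n (fun y => f (Ψ t y)) (u x) (e k)))
      (by
        filter_upwards [isOpen_Ioo.mem_nhds h.zero_mem] with t ht l k
        exact (hd t ht l).inner ℝ (hd t ht k))
      (fun l k => ((hd 0 h.zero_mem l).inner ℝ (hd' k)).add ((hd' l).inner ℝ (hd 0 h.zero_mem k)))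
      (fun l k => by
        simp only [hb, hf.spaceDeriv_eq, hf.inner_euclideanDeriv_basis])
      (fun l k => by
        rw [add_comm]
        exact congrArg₂ _ (real_inner_comm _ _) (real_inner_comm _ _))]
  simp only [h.timeDeriv_zero, hb, hf.spaceDeriv_eq]
  congr 1
  · rw [Finset.sum_div]
    refine Finset.sum_congr rfl fun l _ => ?_
    rw [real_inner_comm (euclideanDeriv f (u x) (e l))]
    ring
  · refine Finset.sum_congr rfl fun l _ => Finset.sum_congr rfl fun k _ => ?_
    rw [real_inner_comm (spaceDeriv n Z (u x) (e k)), add_comm]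

end DeformationEnergy

/-! ### The averaged second variation -/

section AveragedVariation

variable {n q : ℕ} {N : Type*} [TopologicalSpace N] [ChartedSpace (EuclideanSpace ℝ (Fin n)) N]

theorem inner_sub_tangentProj_secondFundamentalForm (f : N → EuclideanSpace ℝ (Fin q)) (y : N)
    (v w : TangentSpace (𝓡 n) y) (a : EuclideanSpace ℝ (Fin q)) :
    inner ℝ (a - tangentProj (n := n) f y a) (secondFundamentalForm f y v w) =
      inner ℝ a (secondFundamentalForm f y v w) := by
  rw [inner_sub_left, inner_tangentProj_left, tangentProj_secondFundamentalForm, inner_zero_right,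
    sub_zero]

variable [RiemannianBundle (fun y : N => TangentSpace (𝓡 n) y)]
  {f : N → EuclideanSpace ℝ (Fin q)}

namespace IsIsometricImmersion

theorem orthonormal_euclideanDeriv (hf : IsIsometricImmersion n f) {y : N}
    (e : OrthonormalBasis (Fin n) ℝ (TangentSpace (𝓡 n) y)) :
    Orthonormal ℝ fun l => euclideanDeriv f y (e l) :=
  orthonormal_iff_ite.2 fun l k => hf.inner_euclideanDeriv_basis e l k

theorem tangentProj_eq_sum (hf : IsIsometricImmersion n f) {y : N}
    (e : OrthonormalBasis (Fin n) ℝ (TangentSpace (𝓡 n) y)) (a : EuclideanSpace ℝ (Fin q)) :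
    tangentProj (n := n) f y a =
      ∑ l, inner ℝ (euclideanDeriv f y (e l)) a • euclideanDeriv f y (e l) := by
  refine Submodule.eq_starProjection_of_mem_of_inner_eq_zero
    (Submodule.sum_mem _ fun l _ => Submodule.smul_mem _ _ ⟨e l, rfl⟩) ?_
  rintro _ ⟨w, rfl⟩
  rw [ContinuousLinearMap.coe_coe, ← e.sum_repr' w, map_sum, inner_sum]
  refine Finset.sum_eq_zero fun k _ => ?_
  rw [map_smul, inner_smul_right, inner_sub_left, sum_inner]
  simp only [inner_smul_left, hf.inner_euclideanDeriv_basis, mul_ite, mul_one, mul_zero,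
    Finset.sum_ite_eq', Finset.mem_univ, if_true, conj_trivial]
  rw [real_inner_comm a, sub_self, mul_zero]

/-- The tangential parts of an orthonormal basis of `ℝ^q` compute traces over the tangent space. -/
theorem sum_secondFundamentalForm_tangential (hf : IsIsometricImmersion n f) {y : N}
    (e : OrthonormalBasis (Fin n) ℝ (TangentSpace (𝓡 n) y)) {κ : Type*} [Fintype κ]
    (b : OrthonormalBasis κ ℝ (EuclideanSpace ℝ (Fin q))) :
    ∑ a, secondFundamentalForm f y (∑ l, inner ℝ (euclideanDeriv f y (e l)) (b a) • e l)
      (∑ l, inner ℝ (euclideanDeriv f y (e l)) (b a) • e l) =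
      ∑ k, secondFundamentalForm f y (e k) (e k) := by
  simp only [← secondFundamentalFormₗ_apply, map_sum, map_smul, LinearMap.sum_apply,
    LinearMap.smul_apply, Finset.smul_sum, smul_smul]
  rw [Finset.sum_comm]
  refine Finset.sum_congr rfl fun l _ => ?_
  rw [Finset.sum_comm]
  have h : ∀ k, ∑ a, inner ℝ (euclideanDeriv f y (e l)) (b a) *
      inner ℝ (euclideanDeriv f y (e k)) (b a) = if l = k then (1 : ℝ) else 0 := fun k => by
    rw [← hf.inner_euclideanDeriv_basis, ← b.sum_inner_mul_inner]
    exact Finset.sum_congr rfl fun a _ => by rw [real_inner_comm (b a) (euclideanDeriv f y (e k))]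
  simp only [← Finset.sum_smul, h, ite_smul, one_smul, zero_smul, Finset.sum_ite_eq,
    Finset.mem_univ, if_true]

variable [IsManifold (𝓡 n) ∞ N]

/-- Gauss equation for the tangential parts of an orthonormal basis of `ℝ^q`: the derivatives
`D_v P` of the tangential projection have norm `2 |B(v, ·)|²`. -/
theorem sum_inner_spaceDeriv_tangentProj (hf : IsIsometricImmersion n f) {y : N}
    (e : OrthonormalBasis (Fin n) ℝ (TangentSpace (𝓡 n) y)) {κ : Type*} [Fintype κ]
    (b : OrthonormalBasis κ ℝ (EuclideanSpace ℝ (Fin q))) (v : TangentSpace (𝓡 n) y) :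
    ∑ a, inner ℝ (spaceDeriv n (fun y => tangentProj (n := n) f y (b a)) y v)
      (spaceDeriv n (fun y => tangentProj (n := n) f y (b a)) y v) =
      2 * ∑ k, inner ℝ (secondFundamentalForm f y v (e k)) (secondFundamentalForm f y v (e k)) := by
  simp only [hf.spaceDeriv_tangentProj_apply, ← hf.spaceDeriv_tangentProj_euclideanDeriv]
  exact sum_norm_sq_eq_two_mul_of_projection b (hf.orthonormal_euclideanDeriv e)
    (tangentProj (n := n) f y).toLinearMap (spaceDeriv n (tangentProj (n := n) f) y v).toLinearMap
    (hf.tangentProj_eq_sum e) (hf.inner_spaceDeriv_tangentProj y v)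
    (hf.spaceDeriv_tangentProj_eq y v)

theorem inner_spaceDeriv_tangentProj_add (hf : IsIsometricImmersion n f) (y : N)
    (v w : TangentSpace (𝓡 n) y) (a : EuclideanSpace ℝ (Fin q)) :
    inner ℝ (spaceDeriv n (fun y => tangentProj (n := n) f y a) y v) (euclideanDeriv f y w) +
      inner ℝ (spaceDeriv n (fun y => tangentProj (n := n) f y a) y w) (euclideanDeriv f y v) =
      2 * inner ℝ a (secondFundamentalForm f y v w) := by
  simp only [hf.spaceDeriv_tangentProj_apply, hf.inner_spaceDeriv_tangentProj,
    hf.spaceDeriv_tangentProj_euclideanDeriv]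
  rw [hf.secondFundamentalForm_comm y w v]
  ring

end IsIsometricImmersion

theorem IsDeformation.smoothInCharts_acceleration [IsManifold (𝓡 n) ∞ N]
    {Z : N → EuclideanSpace ℝ (Fin q)} {δ : ℝ} {Ψ : ℝ → N → N} (h : IsDeformation n f Z δ Ψ)
    (hf : IsIsometricImmersion n f) :
    SmoothInCharts n (timeDeriv (timeDeriv fun t y => f (Ψ t y)) 0) :=
  (h.smoothFamily hf.1).smoothFamily_timeDeriv.smoothFamily_timeDeriv.slice h.zero_mem

variable [IsManifold (𝓡 n) ∞ N] {κ : Type*} [Fintype κ]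
  {b : OrthonormalBasis κ ℝ (EuclideanSpace ℝ (Fin q))} {δ : κ → ℝ} {Ψ : κ → ℝ → N → N}

/-- The accelerations `ζ_a` of deformations with velocities `P b_a` enter the averaged second
variation only through their normal parts, whose sum is the trace of `B`: what is left of the
tangential parts is the first variation along `P (∑ ζ_a)`. -/
theorem IsIsometricImmersion.sum_inner_spaceDeriv_acceleration (hf : IsIsometricImmersion n f)
    (h : ∀ a, IsDeformation n f (fun y => tangentProj (n := n) f y (b a)) (δ a) (Ψ a)) {y : N}
    (e : OrthonormalBasis (Fin n) ℝ (TangentSpace (𝓡 n) y)) (v : TangentSpace (𝓡 n) y) :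
    ∑ a, inner ℝ (spaceDeriv n (timeDeriv (timeDeriv fun t y => f (Ψ a t y)) 0) y v)
        (euclideanDeriv f y v) -
      inner ℝ (spaceDeriv n (fun y => tangentProj (n := n) f y
        (∑ a, timeDeriv (timeDeriv fun t y => f (Ψ a t y)) 0 y)) y v) (euclideanDeriv f y v) =
      - ∑ k, inner ℝ (secondFundamentalForm f y v v) (secondFundamentalForm f y (e k) (e k)) := by
  have hζ := fun a => (h a).smoothInCharts_acceleration hf
  have hc := SmoothInCharts.sum Finset.univ hζ
  have hPc : SmoothInCharts n (fun y => tangentProj (n := n) f y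
      (∑ a, timeDeriv (timeDeriv fun t y => f (Ψ a t y)) 0 y)) := fun p =>
    (hf.smoothInCharts_tangentProj p).clm_apply (hc p)
  rw [← sum_inner, ← spaceDeriv_sum Finset.univ hζ, ← inner_sub_left, ← hc.spaceDeriv_sub hPc,
    hf.inner_spaceDeriv_normal hc, ← inner_sub_tangentProj_secondFundamentalForm, map_sum,
    ← Finset.sum_sub_distrib, ← inner_sum, ← hf.sum_secondFundamentalForm_tangential e b,
    real_inner_comm]
  refine congrArg (fun w => - inner ℝ (secondFundamentalForm f y v v) w)
    (Finset.sum_congr rfl fun a _ => hf.normal_acceleration (h a) y _ ?_)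
  rw [hf.tangentProj_eq_sum e, map_sum]
  simp only [map_smul]

variable {m : ℕ} {M : Type*} [TopologicalSpace M] [ChartedSpace (EuclideanSpace ℝ (Fin m)) M]
  [RiemannianBundle (fun x : M => TangentSpace (𝓡 m) x)] {u : M → N}

/-- The second variations along the tangential parts of an orthonormal basis of `ℝ^q`, corrected by
a first variation, are bounded pointwise by the quadratic expression in `B` that defines
superstrong instability, evaluated in principal directions of `u`. -/
theorem IsIsometricImmersion.sum_second_variation_le (hf : IsIsometricImmersion n f)
    (h : ∀ a, IsDeformation n f (fun y => tangentProj (n := n) f y (b a)) (δ a) (Ψ a))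
    {δ' : ℝ} {Ψ' : ℝ → N → N} (h' : IsDeformation n f (fun y => tangentProj (n := n) f y
      (∑ a, timeDeriv (timeDeriv fun t y => f (Ψ a t y)) 0 y)) δ' Ψ')
    (hu : ContMDiff (𝓡 m) (𝓡 n) ∞ u) (x : M)
    (e : OrthonormalBasis (Fin n) ℝ (TangentSpace (𝓡 n) (u x))) (μ : Fin n → ℝ)
    (hμ0 : ∀ l, 0 ≤ μ l)
    (hμ : ∀ l k, ∑ i, inner ℝ (mfderiv (𝓡 m) (𝓡 n) u x (tangentFrame x i)) (e l) *
      inner ℝ (mfderiv (𝓡 m) (𝓡 n) u x (tangentFrame x i)) (e k) = if l = k then μ l else 0) :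
    ∑ a, timeDeriv (timeDeriv fun t => phiThreeDensity m n (fun x => Ψ a t (u x))) 0 x -
      timeDeriv (fun t => phiThreeDensity m n (fun x => Ψ' t (u x))) 0 x ≤
      ∑ l, μ l ^ 3 * ∑ k, (6 * inner ℝ (secondFundamentalForm f (u x) (e l) (e k))
          (secondFundamentalForm f (u x) (e l) (e k)) -
        inner ℝ (secondFundamentalForm f (u x) (e l) (e l))
          (secondFundamentalForm f (u x) (e k) (e k))) := by
  have hT := h'.timeDeriv_phiThreeDensity hf hu x e μ hμ
  have h2 := fun a => (h a).timeDeriv_timeDeriv_phiThreeDensity hf hu x e μ hμ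
  simp only [h2, hT, hf.inner_spaceDeriv_tangentProj_add]
  rw [Finset.sum_add_distrib, Finset.sum_comm]
  have hle : ∑ a, ∑ l, ∑ k, μ l ^ 2 * μ k *
      (2 * inner ℝ (b a) (secondFundamentalForm f (u x) (e l) (e k))) ^ 2 ≤
      ∑ l, μ l ^ 3 * (4 * ∑ k, inner ℝ (secondFundamentalForm f (u x) (e l) (e k))
          (secondFundamentalForm f (u x) (e l) (e k))) := by
    refine (Finset.sum_le_sum fun a _ => sum_sq_mul_le_sum_cube μ hμ0 _ fun l k => by
      rw [hf.secondFundamentalForm_comm]).trans (le_of_eq ?_)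
    rw [Finset.sum_comm]
    refine Finset.sum_congr rfl fun l _ => ?_
    rw [← Finset.mul_sum, Finset.sum_comm, Finset.mul_sum _ _ (4 : ℝ)]
    congr 1
    refine Finset.sum_congr rfl fun k _ => ?_
    rw [← b.sum_inner_mul_inner, Finset.mul_sum]
    refine Finset.sum_congr rfl fun a _ => ?_
    rw [real_inner_comm (b a)]
    ring
  refine (sub_le_sub_right (add_le_add_right hle _) _).trans (le_of_eq ?_)
  rw [← Finset.sum_add_distrib, ← Finset.sum_sub_distrib]
  refine Finset.sum_congr rfl fun l _ => ?_
  rw [← Finset.mul_sum, ← mul_add, ← mul_sub, Finset.sum_add_distrib,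
    hf.sum_inner_spaceDeriv_tangentProj e b, Finset.sum_sub_distrib, ← Finset.mul_sum]
  have h3 := hf.sum_inner_spaceDeriv_acceleration h e (e l)
  congr 1
  linarith

end AveragedVariation

/-! ### Locally constant maps; variations by deformations -/

section LocallyConstant

variable {m n : ℕ} {M N : Type*}
  [TopologicalSpace M] [ChartedSpace (EuclideanSpace ℝ (Fin m)) M] [IsManifold (𝓡 m) ∞ M]
  [TopologicalSpace N] [ChartedSpace (EuclideanSpace ℝ (Fin n)) N] [IsManifold (𝓡 n) ∞ N]
  {u : M → N}

/-- In charts, the mean value inequality. -/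
theorem isLocallyConstant_of_mfderiv_eq_zero (hu : MDifferentiable (𝓡 m) (𝓡 n) u)
    (h0 : ∀ x, mfderiv (𝓡 m) (𝓡 n) u x = 0) : IsLocallyConstant u := by
  rw [IsLocallyConstant.iff_eventually_eq]
  intro x
  set φ := chartAt (EuclideanSpace ℝ (Fin m)) x
  set ψ := chartAt (EuclideanSpace ℝ (Fin n)) (u x)
  have hx : x ∈ φ.source := mem_chart_source _ x
  have hψ : u ⁻¹' ψ.source ∈ nhds x :=
    hu.continuous.continuousAt.preimage_mem_nhds (ψ.open_source.mem_nhds (mem_chart_source _ (u x)))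
  have hS : φ.target ∩ φ.symm ⁻¹' (u ⁻¹' ψ.source) ∈ nhds (φ x) := by
    refine Filter.inter_mem (φ.open_target.mem_nhds (φ.map_source hx)) ?_
    refine (φ.continuousAt_symm (φ.map_source hx)).preimage_mem_nhds ?_
    rwa [φ.left_inv hx]
  obtain ⟨r, hr, hball⟩ := Metric.mem_nhds_iff.1 hS
  have hd : ∀ z ∈ Metric.ball (φ x) r, HasFDerivAt (fun z => ψ (u (φ.symm z)))
      (0 : EuclideanSpace ℝ (Fin m) →L[ℝ] EuclideanSpace ℝ (Fin n)) z := by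
    intro z hz
    have h1 := ((mdifferentiable_chart (I := 𝓡 m) x).mdifferentiableAt_symm
      (hball hz).1).hasMFDerivAt
    have h2 := (hu (φ.symm z)).hasMFDerivAt
    have h3 := ((mdifferentiable_chart (I := 𝓡 n) (u x)).mdifferentiableAt
      (hball hz).2).hasMFDerivAt
    have h4 := h3.comp z (h2.comp z h1)
    rw [h0, ContinuousLinearMap.zero_comp, ContinuousLinearMap.comp_zero] at h4
    exact h4.hasFDerivAt
  have hc : ∀ z ∈ Metric.ball (φ x) r, ψ (u (φ.symm z)) = ψ (u (φ.symm (φ x))) := fun z hz =>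
    (convex_ball (φ x) r).is_const_of_fderivWithin_eq_zero (𝕜 := ℝ)
      (f := fun z => ψ (u (φ.symm z)))
      (fun z hz => (hd z hz).differentiableAt.differentiableWithinAt)
      (fun z hz => ((hd z hz).hasFDerivWithinAt).fderivWithin
        (Metric.isOpen_ball.uniqueDiffWithinAt hz)) hz (Metric.mem_ball_self hr)
  filter_upwards [φ.open_source.mem_nhds hx, hψ,
    (φ.continuousAt hx).preimage_mem_nhds (Metric.ball_mem_nhds _ hr)] with y hy hy' hyr
  have := hc (φ y) hyr
  rw [φ.left_inv hy, φ.left_inv hx] at this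
  exact ψ.injOn hy' (mem_chart_source _ (u x)) this

end LocallyConstant

section Stability

variable {m n q : ℕ} {M N : Type*}
  [TopologicalSpace M] [ChartedSpace (EuclideanSpace ℝ (Fin m)) M]
  [TopologicalSpace N] [ChartedSpace (EuclideanSpace ℝ (Fin n)) N]
  {u : M → N} {f Z : N → EuclideanSpace ℝ (Fin q)} {δ : ℝ} {Ψ : ℝ → N → N}

theorem IsDeformation.contMDiffOn_comp (h : IsDeformation n f Z δ Ψ)
    (hu : ContMDiff (𝓡 m) (𝓡 n) ∞ u) :
    ContMDiffOn (𝓘(ℝ, ℝ).prod (𝓡 m)) (𝓡 n) ∞ (fun p : ℝ × M => Ψ p.1 (u p.2))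
      (Ioo (-δ) δ ×ˢ (univ : Set M)) :=
  h.smooth.comp (f := fun p : ℝ × M => (p.1, u p.2))
    (contMDiffOn_fst.prodMk (hu.comp_contMDiffOn contMDiffOn_snd)) fun _ hp => ⟨hp.1, mem_univ _⟩

theorem IsDeformation.isSmoothVariation (h : IsDeformation n f Z δ Ψ)
    (hu : ContMDiff (𝓡 m) (𝓡 n) ∞ u) :
    IsSmoothVariation m n u (fun t x => Ψ t (u x)) :=
  ⟨funext fun x => h.zero (u x), δ, h.pos, h.contMDiffOn_comp hu⟩

variable [RiemannianBundle (fun y : N => TangentSpace (𝓡 n) y)]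

/-- The inequality that defines superstrong instability holds in an arbitrary orthonormal basis, as
its left-hand side is a trace. -/
theorem sum_secondFundamentalForm_neg {y : N}
    (h : ∀ v : TangentSpace (𝓡 n) y, ‖v‖ = 1 → ∑ i : Fin n,
      (6 * inner ℝ (secondFundamentalForm f y v (tangentFrame y i))
          (secondFundamentalForm f y v (tangentFrame y i)) -
        inner ℝ (secondFundamentalForm f y v v)
          (secondFundamentalForm f y (tangentFrame y i) (tangentFrame y i))) < 0)
    (e : OrthonormalBasis (Fin n) ℝ (TangentSpace (𝓡 n) y)) (v : TangentSpace (𝓡 n) y)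
    (hv : ‖v‖ = 1) :
    ∑ k, (6 * inner ℝ (secondFundamentalForm f y v (e k)) (secondFundamentalForm f y v (e k)) -
      inner ℝ (secondFundamentalForm f y v v) (secondFundamentalForm f y (e k) (e k))) < 0 := by
  have h1 := OrthonormalBasis.sum_apply_self_eq e (tangentFrame y)
    (6 • (innerₗ (EuclideanSpace ℝ (Fin q))).compl₁₂ (secondFundamentalFormₗ f y v)
      (secondFundamentalFormₗ f y v) -
      (secondFundamentalFormₗ f y).compr₂ (innerₗ _ (secondFundamentalForm f y v v)))
  refine lt_of_eq_of_lt ?_ (h v hv)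
  simpa [secondFundamentalFormₗ_apply] using h1

end Stability

/-! ### Vanishing of the differential -/

section Vanishing

variable {m n q : ℕ} {M N : Type*}
  [TopologicalSpace M] [ChartedSpace (EuclideanSpace ℝ (Fin m)) M]
  [RiemannianBundle (fun x : M => TangentSpace (𝓡 m) x)]
  [TopologicalSpace N] [ChartedSpace (EuclideanSpace ℝ (Fin n)) N]
  [RiemannianBundle (fun y : N => TangentSpace (𝓡 n) y)] {u : M → N}

/-- The differential vanishes if all principal stretches do. -/
theorem mfderiv_eq_zero_of_principal_stretches {x : M}
    (e : OrthonormalBasis (Fin n) ℝ (TangentSpace (𝓡 n) (u x)))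
    (h : ∀ l, ∑ i, inner ℝ (mfderiv (𝓡 m) (𝓡 n) u x (tangentFrame x i)) (e l) *
      inner ℝ (mfderiv (𝓡 m) (𝓡 n) u x (tangentFrame x i)) (e l) = 0) :
    mfderiv (𝓡 m) (𝓡 n) u x = 0 := by
  have h1 : ∀ i, mfderiv (𝓡 m) (𝓡 n) u x (tangentFrame x i) = 0 := fun i => by
    refine InnerProductSpace.ext_inner_left_basis (𝕜 := ℝ) e.toBasis fun l => ?_
    have := (Finset.sum_eq_zero_iff_of_nonneg fun i _ => mul_self_nonneg _).1 (h l) i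
      (Finset.mem_univ i)
    rw [OrthonormalBasis.coe_toBasis, inner_zero_right, real_inner_comm]
    exact mul_self_eq_zero.1 this
  ext1 v
  rw [← (tangentFrame x).sum_repr' v, map_sum]
  refine Finset.sum_eq_zero fun i _ => ?_
  rw [map_smul, h1, smul_zero]

/-- The averaged second variation at `x` is nonpositive, with equality only where `du` vanishes. -/
theorem IsIsometricImmersion.sum_second_variation_nonpos [IsManifold (𝓡 n) ∞ N]
    {f : N → EuclideanSpace ℝ (Fin q)} (hf : IsIsometricImmersion n f) {κ : Type*} [Fintype κ]
    {b : OrthonormalBasis κ ℝ (EuclideanSpace ℝ (Fin q))} {δ : κ → ℝ} {Ψ : κ → ℝ → N → N}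
    (h : ∀ a, IsDeformation n f (fun y => tangentProj (n := n) f y (b a)) (δ a) (Ψ a))
    {δ' : ℝ} {Ψ' : ℝ → N → N} (h' : IsDeformation n f (fun y => tangentProj (n := n) f y
      (∑ a, timeDeriv (timeDeriv fun t y => f (Ψ a t y)) 0 y)) δ' Ψ')
    (hu : ContMDiff (𝓡 m) (𝓡 n) ∞ u) {x : M}
    (hB : ∀ v : TangentSpace (𝓡 n) (u x), ‖v‖ = 1 → ∑ i : Fin n,
      (6 * inner ℝ (secondFundamentalForm f (u x) v (tangentFrame (u x) i))
          (secondFundamentalForm f (u x) v (tangentFrame (u x) i)) -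
        inner ℝ (secondFundamentalForm f (u x) v v)
          (secondFundamentalForm f (u x) (tangentFrame (u x) i) (tangentFrame (u x) i))) < 0) :
    ∑ a, timeDeriv (timeDeriv fun t => phiThreeDensity m n (fun x => Ψ a t (u x))) 0 x -
        timeDeriv (fun t => phiThreeDensity m n (fun x => Ψ' t (u x))) 0 x ≤ 0 ∧
      (∑ a, timeDeriv (timeDeriv fun t => phiThreeDensity m n (fun x => Ψ a t (u x))) 0 x -
        timeDeriv (fun t => phiThreeDensity m n (fun x => Ψ' t (u x))) 0 x = 0 →
        mfderiv (𝓡 m) (𝓡 n) u x = 0) := by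
  obtain ⟨e, μ, hμ0, hμ⟩ := exists_orthonormalBasis_diagonal
    (E := TangentSpace (𝓡 n) (u x)) (finrank_tangentSpace (u x))
    fun i => mfderiv (𝓡 m) (𝓡 n) u x (tangentFrame x i)
  have hle := hf.sum_second_variation_le h h' hu x e μ hμ0 hμ
  have hneg := fun l => sum_secondFundamentalForm_neg hB e (e l) (e.norm_eq_one l)
  have hnonpos := fun l => mul_nonpos_of_nonneg_of_nonpos (pow_nonneg (hμ0 l) 3) (hneg l).le
  refine ⟨hle.trans (Finset.sum_nonpos fun l _ => hnonpos l), fun h0 => ?_⟩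
  rw [h0] at hle
  have hzero := (Finset.sum_eq_zero_iff_of_nonpos fun l _ => hnonpos l).1
    (le_antisymm (Finset.sum_nonpos fun l _ => hnonpos l) hle)
  -- Each term is `μ_l³` times a negative number.
  refine mfderiv_eq_zero_of_principal_stretches e fun l => ?_
  rw [hμ, if_pos rfl]
  exact pow_eq_zero_iff three_ne_zero |>.1
    ((mul_eq_zero.1 (hzero l (Finset.mem_univ l))).resolve_right (hneg l).ne)

variable [IsManifold (𝓡 m) ∞ M] [T2Space M] [CompactSpace M]
  [MeasurableSpace M] [BorelSpace M]
  [IsContMDiffRiemannianBundle (𝓡 m) ∞ (EuclideanSpace ℝ (Fin m))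
    (fun x : M => TangentSpace (𝓡 m) x)] [IsManifold (𝓡 n) ∞ N]

/-- The differential of a stable map to a superstrongly unstable manifold vanishes. -/
theorem IsStablePhiThreeHarmonic.mfderiv_eq_zero [T2Space N] [CompactSpace N]
    (hu : IsStablePhiThreeHarmonic m n u) (hN : IsPhiThreeSSU n N) (x : M) :
    mfderiv (𝓡 m) (𝓡 n) u x = 0 := by
  obtain ⟨q, f, hf, hB⟩ := hN
  obtain ⟨⟨hus, hcrit⟩, hstab⟩ := hu
  set b := EuclideanSpace.basisFun (Fin q) ℝ
  choose δ Ψ h using fun a => hf.exists_isDeformation (c := fun _ => b a)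
    fun _ => contDiffOn_const
  -- A variation along the tangential part of the sum of the accelerations; its first variation
  -- cancels the terms of the second variations that depend on the choice of `Ψ`.
  obtain ⟨δ', Ψ', h'⟩ := hf.exists_isDeformation
    (SmoothInCharts.sum Finset.univ fun a => (h a).smoothInCharts_acceleration hf)
  set R : M → ℝ := fun x =>
    ∑ a, timeDeriv (timeDeriv fun t => phiThreeDensity m n (fun x => Ψ a t (u x))) 0 x -
      timeDeriv (fun t => phiThreeDensity m n (fun x => Ψ' t (u x))) 0 x with hR
  have hS := fun a => hf.smoothFamily_phiThreeDensity (U := fun t x => Ψ a t (u x))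
    ((h a).contMDiffOn_comp hus)
  have hS' := hf.smoothFamily_phiThreeDensity (U := fun t x => Ψ' t (u x))
    (h'.contMDiffOn_comp hus)
  have hcont : Continuous R := (continuous_finsetSum _ fun a _ =>
    (hS a).smoothFamily_timeDeriv.smoothFamily_timeDeriv.continuous_slice (h a).zero_mem).sub
      (hS'.smoothFamily_timeDeriv.continuous_slice h'.zero_mem)
  have hint := fun a => (hS a).smoothFamily_timeDeriv.smoothFamily_timeDeriv.integrable_slice
    (h a).zero_mem (riemannianVolume m M)
  have hint' := hS'.smoothFamily_timeDeriv.integrable_slice h'.zero_mem (riemannianVolume m M)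
  have hRint : 0 ≤ ∫ x, R x ∂riemannianVolume m M := by
    rw [hR, integral_sub (integrable_finsetSum _ fun a _ => hint a) hint',
      integral_finsetSum _ fun a _ => hint a,
      ← (hcrit _ (h'.isSmoothVariation hus)).unique
        (hS'.hasDerivAt_integral h'.zero_mem (riemannianVolume m M)), sub_zero]
    refine Finset.sum_nonneg fun a _ => ?_
    rw [← (hS a).iteratedDeriv_two_integral (h a).pos]
    exact hstab _ ((h a).isSmoothVariation hus)
  have hx := fun x => hf.sum_second_variation_nonpos h h' hus (hB (u x))
  have hR0 : R = 0 := by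
    have hRi : Integrable R (riemannianVolume m M) :=
      (integrable_finsetSum _ fun a _ => hint a).sub hint'
    have h1 : ∫ x, -R x ∂riemannianVolume m M = 0 := by
      rw [integral_neg]
      have := integral_nonpos (μ := riemannianVolume m M) fun x => (hx x).1
      linarith
    have h2 := (integral_eq_zero_iff_of_nonneg (fun x => neg_nonneg.2 ((hx x).1)) hRi.neg).1 h1
    have h3 := hcont.neg.ae_eq_iff_eq (μ := riemannianVolume m M) continuous_zero |>.1 h2
    exact neg_eq_zero.1 h3
  exact (hx x).2 (congrFun hR0 x)

end Vanishing

theorem theorem8p1 {m n : ℕ} {M N : Type*}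
    [TopologicalSpace M] [ChartedSpace (EuclideanSpace ℝ (Fin m)) M] [IsManifold (𝓡 m) ∞ M]
    [T2Space M] [CompactSpace M] [ConnectedSpace M]
    [MeasurableSpace M] [BorelSpace M]
    [RiemannianBundle (fun x : M => TangentSpace (𝓡 m) x)]
    [IsContMDiffRiemannianBundle (𝓡 m) ∞ (EuclideanSpace ℝ (Fin m))
      (fun x : M => TangentSpace (𝓡 m) x)]
    [TopologicalSpace N] [ChartedSpace (EuclideanSpace ℝ (Fin n)) N] [IsManifold (𝓡 n) ∞ N]
    [T2Space N] [CompactSpace N]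
    [RiemannianBundle (fun y : N => TangentSpace (𝓡 n) y)]
    [IsContMDiffRiemannianBundle (𝓡 n) ∞ (EuclideanSpace ℝ (Fin n))
      (fun y : N => TangentSpace (𝓡 n) y)]
    (hN : IsPhiThreeSSU n N) (u : M → N) (hu : IsStablePhiThreeHarmonic m n u) :
    ∃ c : N, ∀ x : M, u x = c := by
  have hloc := isLocallyConstant_of_mfderiv_eq_zero (hu.1.1.mdifferentiable (by simp))
    (hu.mfderiv_eq_zero hN)
  obtain ⟨x₀⟩ := (inferInstance : Nonempty M)
  exact ⟨u x₀, fun x => hloc.apply_eq_of_preconnectedSpace x x₀⟩
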